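/- For an integer $d\ge 1$ let $Q^d$ be the binary hypercube: its vertices are the elements of $\{0,1\}^d$, two of them being adjacent if they differ in exactly one coordinate. For $p,q\in[0,1]$, let $Q^d_{p,q}$ be the random subgraph of $Q^d$ obtained by retaining every vertex with probability $p$ and every edge with probability $q$, all independently; its vertices are the retained vertices, and its edges are the retained edges both of whose endpoints are retained. For a graph $H$ and $S\subseteq V(H)$, let $N_H(S)$ be the set of vertices of $V(H)\setminus S$ that have a neighbour in $S$ in the graph $H$. **Proposition.** There is a function $g:(0,\infty)\to(0,\infty)$ such that for all $p,q,\alpha\in(0,1]$ there is $\eta_0=\eta_0(p,q,\alpha)>0$ with the following property. For every $\eta\in(0,\eta_0]$, every $\gamma\in(0,g(\eta)]$ and every integer $d\ge 1$, with probability at least $1-2^{-\eta d^{3/2}}$ the following holds: every set $S\subseteq V(Q^d_{p,q})$ with $|S|\le \tfrac34|V(Q^d_{p,q})|$ such that every $v\in S$ has degree at least $\alpha d$ in $Q^d_{p,q}$ satisfies $$|N_{Q^d_{p,q}}(S)|\ \ge\ \frac{\gamma|S|}{\sqrt d}.$$ -/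

import Mathlib

open MeasureTheory ProbabilityTheory

namespace MixedPercolation

/-- The `d`-dimensional binary hypercube: vertices are the `0/1`-vectors of length `d`, and two of
them are adjacent iff they differ in exactly one coordinate. -/
def hypercube (d : ℕ) : SimpleGraph (Fin d → Bool) where
  Adj x y := hammingDist x y = 1
  symm := ⟨fun x y h => by rw [hammingDist_comm]; exact h⟩
  loopless := ⟨fun x h => by simp at h⟩

variable {V : Type*}

/-- The subgraph of `G` with vertex set `U` whose edges are the edges of `G` that belong to `F` and
have both endpoints in `U`. -/
def retained (G : SimpleGraph V) (U : Set V) (F : Set (Sym2 V)) : G.Subgraph where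
  verts := U
  Adj v w := G.Adj v w ∧ v ∈ U ∧ w ∈ U ∧ s(v, w) ∈ F
  adj_sub h := h.1
  edge_vert h := h.2.1
  symm := ⟨fun v w h => ⟨h.1.symm, h.2.2.1, h.2.1, by rw [Sym2.eq_swap]; exact h.2.2.2⟩⟩

/-- The joint law of the pair (set of retained vertices, set of retained edges) in mixed percolation
on `G`: every vertex is retained with probability `p` and every edge of `G` with probability `q`,
all independently. -/
noncomputable def mixedLaw (G : SimpleGraph V) (p q : unitInterval) :
    Measure (Set V × Set (Sym2 V)) :=
  (setBernoulli Set.univ p).prod (setBernoulli G.edgeSet q)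

/-- The external vertex-neighbourhood of `S` in the subgraph `H`. -/
def extNbhd {G : SimpleGraph V} (H : G.Subgraph) (S : Set V) : Set V :=
  (⋃ v ∈ S, H.neighborSet v) \ S

/-- Every set `S` that contains at most `3/4` of the vertices of `H` and all of whose vertices have
degree at least `δ` in `H` has at least `c * |S|` external neighbours in `H`. -/
def HighDegreeSetsExpand {G : SimpleGraph V} (H : G.Subgraph) (δ c : ℝ) : Prop :=
  ∀ S : Set V, S ⊆ H.verts →
    (S.ncard : ℝ) ≤ 3 * (H.verts.ncard : ℝ) / 4 →
    (∀ v ∈ S, δ ≤ ((H.neighborSet v).ncard : ℝ)) →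
    c * (S.ncard : ℝ) ≤ ((extNbhd H S).ncard : ℝ)

end MixedPercolation

/-! Suppose that S, a set of retained vertices of degree at least αd, has an external neighbourhood
T with |T| < γ|S|/√d. Talagrand's inequality gives about |S|/√d disjoint hypercube edges leaving S
unless S is nearly everything, so a fixed S is bad with probability exp(-Θ(|S|/√d)). There are too
many sets S for a union bound, so S is replaced by a fingerprint Y ⊆ S from a much smaller family.

Fingerprints exist because of the degree condition. As T is tiny, almost every v in S has order d
neighbours in S which themselves have order d neighbours in S; two vertices have at most two common
neighbours, so v has order d² second neighbours in S. Hence |S| is at least of order d², which is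
where the exponent d^{3/2} comes from. A suitable sequence of k ≈ κ|S|/d^{3/2} vertices of S hits
nearly all these second neighbourhoods, and the set Y of its neighbours in S contains many
neighbours of almost every v in S (`exists_fingerprint`). There are at most 2^{2dk} such Y, which
the bound exp(-β|S|/√d) absorbs.

Fix Y and let A be its robust neighbourhood. If A misses a positive proportion of the cube, take a
large matching leaving A. An open matching edge whose end in A is in Y, or joined to Y by an open
edge, must meet T or S \ A, and both are small (`exists_rare_event_of_density_le`). If A is almost
everything, almost all retained vertices have an open edge to Y and so lie in S ∪ T, against |S| ≤
3/4 of the retained vertices (`exists_rare_event_few_missed`). `measureReal_not_expand_le` sums over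
sizes and fingerprints. The finitely many small d are covered by the positive probability that
everything is retained. -/

namespace MixedPercolation

/-! ### Product probabilities and a Chernoff bound. -/

section Probability

variable {ι : Type*}

lemma setBernoulli_real_superset {u : Set ι} (p : unitInterval) (F : Finset ι) (h : (F : Set ι) ⊆ u) :
    (setBernoulli u p).real {ω | (F : Set ι) ⊆ ω} = (p : ℝ) ^ F.card := by
  classical
  rw [measureReal_def, setBernoulli_apply']
  have : ((fun p : ι → Prop ↦ {i | p i}) ⁻¹' {ω | (F : Set ι) ⊆ ω}) =
      Set.pi (F : Set ι) (fun _ => {True}) := by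
    ext f
    simp [Set.subset_def, Set.pi]
  rw [this, Measure.infinitePi_pi _ (fun i _ => MeasurableSet.of_discrete)]
  rw [Finset.prod_congr rfl (g := fun _ => (unitInterval.toNNReal p : ENNReal))]
  · simp
  · intro i hi
    have : i ∈ u := h hi
    simp [this]

lemma setBernoulli_real_disjoint {u : Set ι} (p : unitInterval) (F : Finset ι) (h : (F : Set ι) ⊆ u) :
    (setBernoulli u p).real {ω | ∀ i ∈ F, i ∉ ω} = (1 - p : ℝ) ^ F.card := by
  classical
  rw [measureReal_def, setBernoulli_apply']
  have : ((fun p : ι → Prop ↦ {i | p i}) ⁻¹' {ω | ∀ i ∈ F, i ∉ ω}) =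
      Set.pi (F : Set ι) (fun _ => {False}) := by
    ext f
    simp [Set.pi]
  rw [this, Measure.infinitePi_pi _ (fun i _ => MeasurableSet.of_discrete)]
  rw [Finset.prod_congr rfl (g := fun _ => (unitInterval.toNNReal (unitInterval.symm p) : ENNReal))]
  · simp
  · intro i hi
    have : i ∈ u := h hi
    simp [this]

variable {V : Type*}

lemma mixedLaw_real_superset (G : SimpleGraph V) (p q : unitInterval) (U : Finset V)
    (F : Finset (Sym2 V)) (hF : (F : Set (Sym2 V)) ⊆ G.edgeSet) :
    (mixedLaw G p q).real {ω | (U : Set V) ⊆ ω.1 ∧ (F : Set (Sym2 V)) ⊆ ω.2} =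
      (p : ℝ) ^ U.card * (q : ℝ) ^ F.card := by
  have : {ω : Set V × Set (Sym2 V) | (U : Set V) ⊆ ω.1 ∧ (F : Set (Sym2 V)) ⊆ ω.2} =
      {ω | (U : Set V) ⊆ ω} ×ˢ {ω | (F : Set (Sym2 V)) ⊆ ω} := by
    ext ω; simp
  rw [this, mixedLaw, measureReal_prod_prod, setBernoulli_real_superset p U (Set.subset_univ _),
    setBernoulli_real_superset q F hF]

lemma mixedLaw_real_disjoint (G : SimpleGraph V) (p q : unitInterval)
    (F : Finset (Sym2 V)) (hF : (F : Set (Sym2 V)) ⊆ G.edgeSet) :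
    (mixedLaw G p q).real {ω | ∀ e ∈ F, e ∉ ω.2} = (1 - q : ℝ) ^ F.card := by
  have : {ω : Set V × Set (Sym2 V) | ∀ e ∈ F, e ∉ ω.2} =
      Set.univ ×ˢ {ω | ∀ e ∈ F, e ∉ ω} := by
    ext ω; simp
  rw [this, mixedLaw, measureReal_prod_prod, setBernoulli_real_disjoint q F hF]
  simp

instance (G : SimpleGraph V) (p q : unitInterval) : IsProbabilityMeasure (mixedLaw G p q) := by
  unfold mixedLaw; infer_instance

lemma measurableSet_superset [Countable V] (U : Finset V)
    (F : Finset (Sym2 V)) :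
    MeasurableSet {ω : Set V × Set (Sym2 V) | (U : Set V) ⊆ ω.1 ∧ (F : Set (Sym2 V)) ⊆ ω.2} := by
  have : {ω : Set V × Set (Sym2 V) | (U : Set V) ⊆ ω.1 ∧ (F : Set (Sym2 V)) ⊆ ω.2} =
      (⋂ v ∈ U, {ω | v ∈ ω.1}) ∩ ⋂ e ∈ F, {ω | e ∈ ω.2} := by
    ext ω; simp [Set.subset_def]
  rw [this]
  refine MeasurableSet.inter (Finset.measurableSet_biInter _ fun v _ => ?_)
    (Finset.measurableSet_biInter _ fun v _ => ?_)
  · exact measurableSet_setOfPred.2 ((measurable_set_mem v).comp measurable_fst)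
  · exact measurableSet_setOfPred.2 ((measurable_set_mem v).comp measurable_snd)

open Classical in
/-- A Chernoff-type lower tail bound for the number of independent events that occur. -/
lemma measureReal_card_le_le_exp {Ω : Type*} [MeasurableSpace Ω] (μ : Measure Ω)
    [IsProbabilityMeasure μ] (I : Finset ι) (E : ι → Set Ω) (hE : ∀ i, MeasurableSet (E i))
    (w : ι → ℝ) {r : ℝ} (hw : ∀ i ∈ I, r ≤ w i)
    (hind : ∀ J ⊆ I, μ.real (⋂ i ∈ J, E i) = ∏ i ∈ J, w i) :
    μ.real {ω | ((I.filter fun i => ω ∈ E i).card : ℝ) ≤ r * I.card / 4} ≤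
      Real.exp (-(r * I.card / 4)) := by
  have hw1 : ∀ i ∈ I, w i ≤ 1 := by
    intro i hi
    have := hind {i} (by simpa using hi)
    simp only [Finset.mem_singleton, Set.iInter_iInter_eq_left, Finset.prod_singleton] at this
    rw [← this]; exact measureReal_le_one
  -- This is 2 to the power minus the number of events that occur. Expanding it over subsets of `I`
  -- makes its mean computable from the intersection probabilities alone.
  set f : Ω → ℝ := fun ω => ∏ i ∈ I, (1 + (-(1 / 2)) * (E i).indicator 1 ω) with hf
  have hf1 : f = fun ω => ∑ J ∈ I.powerset, (-(1 / 2)) ^ J.card * (⋂ i ∈ J, E i).indicator 1 ω := by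
    ext ω
    simp only [hf]
    rw [Finset.prod_one_add]
    refine Finset.sum_congr rfl fun J hJ => ?_
    rw [Finset.prod_mul_distrib, Finset.prod_const]
    congr 1
    by_cases h : ω ∈ ⋂ i ∈ J, E i
    · rw [Set.indicator_of_mem h]
      refine Finset.prod_eq_one fun i hi => ?_
      rw [Set.indicator_of_mem]; rfl
      exact (Set.mem_iInter₂.1 h) i hi
    · rw [Set.indicator_of_notMem h]
      simp only [Set.mem_iInter, not_forall] at h
      obtain ⟨i, hi, h⟩ := h
      exact Finset.prod_eq_zero hi (Set.indicator_of_notMem h _)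
  have hm : ∀ J : Finset ι, MeasurableSet (⋂ i ∈ J, E i) := fun J =>
    Finset.measurableSet_biInter _ fun i _ => hE i
  have hint : ∀ J : Finset ι, Integrable (fun ω => (-(1 / 2 : ℝ)) ^ J.card *
      (⋂ i ∈ J, E i).indicator (1 : Ω → ℝ) ω) μ := fun J =>
    ((integrable_const (1 : ℝ)).indicator (hm J)).const_mul _
  have hfint : Integrable f μ := by
    rw [hf1]; exact integrable_finsetSum _ fun J _ => hint J
  have hmean : ∫ ω, f ω ∂μ = ∏ i ∈ I, (1 + (-(1 / 2)) * w i) := by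
    rw [hf1, integral_finsetSum _ fun J _ => hint J, Finset.prod_one_add]
    refine Finset.sum_congr rfl fun J hJ => ?_
    rw [integral_const_mul, integral_indicator_one (hm J), hind J (Finset.mem_powerset.1 hJ),
      Finset.prod_mul_distrib, Finset.prod_const]
  have hmean' : ∫ ω, f ω ∂μ ≤ Real.exp (-(r * I.card / 2)) := by
    rw [hmean]
    calc _ ≤ ∏ i ∈ I, Real.exp (-(r / 2)) := by
          refine Finset.prod_le_prod (fun i hi => by linarith [hw1 i hi]) fun i hi => ?_
          have := Real.add_one_le_exp (-(r / 2))
          linarith [hw i hi]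
      _ = _ := by
          rw [Finset.prod_const, ← Real.exp_nat_mul]; congr 1; ring
  have hfval : ∀ ω, f ω = Real.exp (-(Real.log 2 * (I.filter fun i => ω ∈ E i).card)) := by
    intro ω
    simp only [hf]
    have : ∀ i ∈ I, (1 + (-(1 / 2)) * (E i).indicator (1 : Ω → ℝ) ω) =
        if ω ∈ E i then (1 / 2 : ℝ) else 1 := by
      intro i _
      split_ifs with h
      · rw [Set.indicator_of_mem h]; norm_num
      · rw [Set.indicator_of_notMem h]; norm_num
    rw [Finset.prod_congr rfl this, Finset.prod_ite, Finset.prod_const, Finset.prod_const_one,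
      mul_one, mul_comm, ← mul_neg, Real.exp_nat_mul, Real.exp_neg, Real.exp_log (by norm_num)]
    norm_num
  have hnn : 0 ≤ᵐ[μ] f := Filter.Eventually.of_forall fun ω => by
    rw [hfval]; exact (Real.exp_pos _).le
  -- Markov's inequality at the level exp(-r|I|/4); the mean is at most the square of this level.
  have hmk := mul_meas_ge_le_integral_of_nonneg hnn hfint (Real.exp (-(r * I.card / 4)))
  have hsub : {ω | ((I.filter fun i => ω ∈ E i).card : ℝ) ≤ r * I.card / 4} ⊆
      {ω | Real.exp (-(r * I.card / 4)) ≤ f ω} := by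
    intro ω hω
    simp only [Set.mem_ofPred_eq] at hω ⊢
    rw [hfval]
    apply Real.exp_le_exp.2
    have h2 : Real.log 2 ≤ 1 := by linarith [Real.log_two_lt_d9]
    have h3 : 0 ≤ ((I.filter fun i => ω ∈ E i).card : ℝ) := by positivity
    have h4 : Real.log 2 * ((I.filter fun i => ω ∈ E i).card : ℝ) ≤ 1 * _ :=
      mul_le_mul_of_nonneg_right h2 h3
    linarith
  have h5 := measureReal_mono (μ := μ) hsub
  have h6 : Real.exp (-(r * I.card / 4)) * μ.real {ω | Real.exp (-(r * I.card / 4)) ≤ f ω} ≤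
      Real.exp (-(r * I.card / 4)) * Real.exp (-(r * I.card / 4)) := by
    rw [← Real.exp_add]
    refine hmk.trans (hmean'.trans (le_of_eq ?_))
    congr 1; ring
  exact h5.trans (le_of_mul_le_mul_left h6 (Real.exp_pos _))

end Probability

/-! ### Talagrand's isoperimetric inequality. -/

section Cube

/-- The neighbour of `x` in the hypercube that differs from `x` in the coordinate `i`. -/
def flip {d : ℕ} (x : Fin d → Bool) (i : Fin d) : Fin d → Bool := Function.update x i (!x i)

lemma flip_flip {d : ℕ} (x : Fin d → Bool) (i : Fin d) : flip (flip x i) i = x := by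
  simp [flip]

lemma flip_cons_zero {d : ℕ} (b : Bool) (x : Fin d → Bool) :
    flip (Fin.cons b x : Fin (d + 1) → Bool) 0 = Fin.cons (!b) x := by
  simp [flip]

lemma flip_cons_succ {d : ℕ} (b : Bool) (x : Fin d → Bool) (i : Fin d) :
    flip (Fin.cons b x : Fin (d + 1) → Bool) i.succ = Fin.cons b (flip x i) := by
  simp [flip, Fin.cons_update]

/-- The number of edges of the hypercube from `x` to the complement of `A`. -/
def outDegree {d : ℕ} (A : Finset (Fin d → Bool)) (x : Fin d → Bool) : ℕ :=
  (Finset.univ.filter fun i => flip x i ∉ A).card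

/-- The density of a set of vertices of the hypercube. -/
noncomputable def density {d : ℕ} (A : Finset (Fin d → Bool)) : ℝ := A.card / 2 ^ d

/-- The normalised sum of the square roots of the outdegrees over a set of vertices. -/
noncomputable def sqrtBoundary {d : ℕ} (A : Finset (Fin d → Bool)) : ℝ :=
  (∑ x ∈ A, √(outDegree A x : ℝ)) / 2 ^ d

/-- The section of a set of vertices of the hypercube at the first coordinate. -/
def slice {d : ℕ} (A : Finset (Fin (d + 1) → Bool)) (b : Bool) : Finset (Fin d → Bool) :=
  Finset.univ.filter fun x => (Fin.cons b x : Fin (d + 1) → Bool) ∈ A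

lemma sum_eq_sum_slices {d : ℕ} (A : Finset (Fin (d + 1) → Bool)) (f : (Fin (d + 1) → Bool) → ℝ) :
    ∑ x ∈ A, f x = ∑ x ∈ slice A false, f (Fin.cons false x) + ∑ x ∈ slice A true, f (Fin.cons true x) := by
  have h : ∑ x ∈ A, f x = ∑ x, if x ∈ A then f x else 0 := by simp
  rw [h, ← (Fin.consEquiv fun _ : Fin (d + 1) => Bool).sum_comp, Fintype.sum_prod_type]
  simp only [Fin.consEquiv, Equiv.coe_fn_mk, Fintype.sum_bool, slice, Finset.sum_filter]
  rw [add_comm]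
  rfl

lemma outDegree_cons {d : ℕ} (A : Finset (Fin (d + 1) → Bool)) (b : Bool) (x : Fin d → Bool) :
    (outDegree A (Fin.cons b x) : ℝ) =
      outDegree (slice A b) x + if x ∈ slice A (!b) then 0 else 1 := by
  unfold outDegree
  rw [Finset.card_filter, Fin.sum_univ_succ, Finset.card_filter]
  simp only [flip_cons_zero, flip_cons_succ, slice, Finset.mem_filter, Finset.mem_univ, true_and]
  push_cast
  split_ifs <;> ring

/-- The triangle inequality for the plane vectors (f i, g i), read in ℂ. -/
lemma sqrt_add_sq_sum_le {ι : Type*} (s : Finset ι) (f g : ι → ℝ) :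
    √((∑ i ∈ s, f i) ^ 2 + (∑ i ∈ s, g i) ^ 2) ≤ ∑ i ∈ s, √(f i ^ 2 + g i ^ 2) := by
  have h := norm_sum_le s fun i => (⟨f i, g i⟩ : ℂ)
  have hn : ∀ a b : ℝ, ‖(⟨a, b⟩ : ℂ)‖ = √(a ^ 2 + b ^ 2) := fun a b => by
    rw [Complex.norm_def, Complex.normSq_mk]; ring_nf
  have hs : ∑ i ∈ s, (⟨f i, g i⟩ : ℂ) = ⟨∑ i ∈ s, f i, ∑ i ∈ s, g i⟩ := by
    apply Complex.ext <;> simp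
  rw [hs, hn] at h
  simpa only [hn] using h

lemma density_eq_slices {d : ℕ} (A : Finset (Fin (d + 1) → Bool)) :
    density A = (density (slice A false) + density (slice A true)) / 2 := by
  have := sum_eq_sum_slices A fun _ => 1
  simp only [Finset.sum_const, nsmul_eq_mul, mul_one] at this
  unfold density
  rw [this, pow_succ]; field_simp

lemma density_nonneg {d : ℕ} (A : Finset (Fin d → Bool)) : 0 ≤ density A := by
  unfold density; positivity

lemma density_le_one {d : ℕ} (A : Finset (Fin d → Bool)) : density A ≤ 1 := by
  unfold density
  rw [div_le_one (by positivity)]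
  have := Finset.card_le_univ A
  simp only [Fintype.card_pi, Fintype.card_bool, Finset.prod_const, Finset.card_univ,
    Fintype.card_fin] at this
  exact_mod_cast this

lemma sqrtBoundary_eq_slices {d : ℕ} (A : Finset (Fin (d + 1) → Bool)) :
    sqrtBoundary A = ((∑ x ∈ slice A false, √(outDegree A (Fin.cons false x) : ℝ)) / 2 ^ d +
      (∑ x ∈ slice A true, √(outDegree A (Fin.cons true x) : ℝ)) / 2 ^ d) / 2 := by
  unfold sqrtBoundary
  rw [sum_eq_sum_slices, pow_succ]; field_simp

lemma sqrtBoundary_slice_le {d : ℕ} (A : Finset (Fin (d + 1) → Bool)) (b : Bool) :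
    sqrtBoundary (slice A b) ≤
      (∑ x ∈ slice A b, √(outDegree A (Fin.cons b x) : ℝ)) / 2 ^ d := by
  unfold sqrtBoundary
  gcongr with x hx
  have := outDegree_cons A b x
  rw [← Nat.cast_le (α := ℝ), this]
  split_ifs <;> linarith

/-- Points of the denser slice that are absent from the other slice gain one boundary edge, and
their density is at least the difference of the two densities. The planar triangle inequality
combines this gain with the boundary inside the slice. -/
lemma sqrt_sqrtBoundary_slice_le {d : ℕ} (A : Finset (Fin (d + 1) → Bool)) (b : Bool)
    (h : density (slice A (!b)) ≤ density (slice A b)) :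
    √(sqrtBoundary (slice A b) ^ 2 + (density (slice A b) - density (slice A (!b))) ^ 2) ≤
      (∑ x ∈ slice A b, √(outDegree A (Fin.cons b x) : ℝ)) / 2 ^ d := by
  have hg : density (slice A b) - density (slice A (!b)) ≤
      (∑ x ∈ slice A b, if x ∈ slice A (!b) then (0 : ℝ) else 1) / 2 ^ d := by
    unfold density
    rw [← sub_div]
    gcongr
    rw [Finset.sum_ite, Finset.sum_const_zero, zero_add, Finset.sum_const, nsmul_eq_mul, mul_one,
      ← Finset.sdiff_eq_filter, sub_le_iff_le_add]
    have := Finset.le_card_sdiff (slice A (!b)) (slice A b)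
    exact_mod_cast (by omega)
  have hpos : (0 : ℝ) < 2 ^ d := by positivity
  calc _ ≤ √(sqrtBoundary (slice A b) ^ 2 +
        ((∑ x ∈ slice A b, if x ∈ slice A (!b) then (0 : ℝ) else 1) / 2 ^ d) ^ 2) := by
        apply Real.sqrt_le_sqrt
        have := pow_le_pow_left₀ (sub_nonneg.2 h) hg 2
        linarith
    _ = √((∑ x ∈ slice A b, √(outDegree (slice A b) x : ℝ)) ^ 2 +
        (∑ x ∈ slice A b, if x ∈ slice A (!b) then (0 : ℝ) else 1) ^ 2) / 2 ^ d := by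
        unfold sqrtBoundary
        rw [div_pow, div_pow, ← add_div, Real.sqrt_div' _ (by positivity), Real.sqrt_sq hpos.le]
    _ ≤ _ := by
        gcongr
        refine (sqrt_add_sq_sum_le _ _ _).trans (Finset.sum_le_sum fun x _ => ?_)
        rw [outDegree_cons, Real.sq_sqrt (by positivity)]
        apply Real.sqrt_le_sqrt
        split_ifs <;> norm_num

/-- The function x(1 - x) at the midpoint exceeds the average of its values at a and b by (a -
b)²/4, so the square root has to exceed a(1 - a) by (a - b)²/2. Squaring leaves a(1 - a) + (a -
b)²/4 ≤ 1, true since the two terms are at most 1/4. -/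
lemma two_point_inequality {a b J : ℝ} (ha : a ≤ 1) (hb : 0 ≤ b) (hab : b ≤ a)
    (hJ : a * (1 - a) ≤ J) :
    (a + b) / 2 * (1 - (a + b) / 2) ≤ (√(J ^ 2 + (a - b) ^ 2) + b * (1 - b)) / 2 := by
  have h0 : 0 ≤ a * (1 - a) := mul_nonneg (by linarith) (by linarith)
  have h1 : a * (1 - a) + (a - b) ^ 2 / 2 ≤ √(J ^ 2 + (a - b) ^ 2) := by
    apply Real.le_sqrt_of_sq_le
    have h2 : (a * (1 - a)) ^ 2 ≤ J ^ 2 := pow_le_pow_left₀ h0 hJ 2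
    have h3 : a * (1 - a) ≤ 1 / 4 := by nlinarith [sq_nonneg (a - 1 / 2)]
    have h4 : (a - b) ^ 2 ≤ 1 := by nlinarith
    have h5 : 0 ≤ (a - b) ^ 2 := sq_nonneg _
    nlinarith [mul_le_mul_of_nonneg_right h3 h5, mul_le_mul_of_nonneg_right h4 h5]
  nlinarith

/-- Talagrand's isoperimetric inequality for the hypercube. -/
theorem density_mul_le_sqrtBoundary {d : ℕ} (A : Finset (Fin d → Bool)) :
    density A * (1 - density A) ≤ sqrtBoundary A := by
  induction d with
  | zero =>
    have : density A = 0 ∨ density A = 1 := by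
      have h : A.card ≤ 1 := by simpa using Finset.card_le_univ A
      unfold density
      interval_cases A.card <;> simp
    have h2 : 0 ≤ sqrtBoundary A := by unfold sqrtBoundary; positivity
    rcases this with h | h <;> rw [h] <;> simpa using h2
  | succ d ih =>
    rw [density_eq_slices, sqrtBoundary_eq_slices]
    -- Only the denser slice is credited with boundary edges in the first coordinate.
    rcases le_total (density (slice A true)) (density (slice A false)) with h | h
    · have h1 := sqrt_sqrtBoundary_slice_le A false h
      have h2 := sqrtBoundary_slice_le A true
      have h3 := two_point_inequality (density_le_one (slice A false)) (density_nonneg _) h (ih _)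
      have h4 := ih (slice A true)
      simp only [Bool.not_false] at h1
      linarith
    · have h1 := sqrt_sqrtBoundary_slice_le A true h
      have h2 := sqrtBoundary_slice_le A false
      have h3 := two_point_inequality (density_le_one (slice A true)) (density_nonneg _) h (ih _)
      have h4 := ih (slice A false)
      simp only [Bool.not_true] at h1
      rw [add_comm (density (slice A false))]
      linarith

end Cube

/-! ### Vertex boundary, matchings across a cut, and second neighbourhoods. -/

section Neighbours

variable {d : ℕ}

/-- The neighbours of a vertex in the hypercube. -/
def cubeNbrs (x : Fin d → Bool) : Finset (Fin d → Bool) := Finset.univ.image (flip x)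

lemma mem_cubeNbrs {x y : Fin d → Bool} : y ∈ cubeNbrs x ↔ ∃ i, flip x i = y := by
  simp [cubeNbrs]

lemma mem_cubeNbrs_comm {x y : Fin d → Bool} : y ∈ cubeNbrs x ↔ x ∈ cubeNbrs y := by
  simp only [mem_cubeNbrs]
  constructor <;> rintro ⟨i, rfl⟩ <;> exact ⟨i, flip_flip _ _⟩

lemma flip_apply_ne_iff {x : Fin d → Bool} {i j : Fin d} : x j ≠ flip x i j ↔ j = i := by
  unfold flip
  by_cases h : j = i
  · subst h; simp
  · simp [h]

lemma hypercube_adj_iff {x y : Fin d → Bool} : (hypercube d).Adj x y ↔ y ∈ cubeNbrs x := by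
  rw [mem_cubeNbrs]
  change hammingDist x y = 1 ↔ _
  unfold hammingDist
  rw [Finset.card_eq_one]
  constructor
  · rintro ⟨i, hi⟩
    refine ⟨i, ?_⟩
    ext j
    have := congrArg (j ∈ ·) hi
    simp only [Finset.mem_filter, Finset.mem_univ, true_and, Finset.mem_singleton, eq_iff_iff] at this
    have h2 := flip_apply_ne_iff (x := x) (i := i) (j := j)
    revert this h2
    cases x j <;> cases y j <;> cases flip x i j <;> simp +contextual
  · rintro ⟨i, rfl⟩
    refine ⟨i, ?_⟩
    ext j
    simpa using flip_apply_ne_iff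

lemma card_cubeNbrs_le (x : Fin d → Bool) : (cubeNbrs x).card ≤ d := by
  simpa [cubeNbrs] using Finset.card_image_le (s := Finset.univ) (f := flip x)

lemma card_common_cubeNbrs_le {v w : Fin d → Bool} (h : w ≠ v) :
    (cubeNbrs v ∩ cubeNbrs w).card ≤ 2 := by
  rcases (cubeNbrs v ∩ cubeNbrs w).eq_empty_or_nonempty with h0 | ⟨u, hu⟩
  · simp [h0]
  rw [Finset.mem_inter, mem_cubeNbrs, mem_cubeNbrs_comm, mem_cubeNbrs] at hu
  obtain ⟨⟨i, rfl⟩, j, rfl⟩ := hu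
  have hij : j ≠ i := by rintro rfl; exact h (flip_flip _ _)
  have hsub : cubeNbrs v ∩ cubeNbrs (flip (flip v i) j) ⊆ ({i, j} : Finset (Fin d)).image (flip v) := by
    intro u hu
    rw [Finset.mem_inter, mem_cubeNbrs, mem_cubeNbrs] at hu
    obtain ⟨⟨k, rfl⟩, l, hl⟩ := hu
    refine Finset.mem_image_of_mem _ ?_
    by_contra hk
    simp only [Finset.mem_insert, Finset.mem_singleton, not_or] at hk
    have hki := congrFun hl k
    have hii := congrFun hl i
    have hjj := congrFun hl j
    unfold flip at hki hii hjj
    by_cases hlk : k = l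
    · subst hlk
      simp [Ne.symm hk.1, hij.symm] at hii
    · simp [hk.1, hk.2, hlk] at hki
  exact (Finset.card_le_card hsub).trans (Finset.card_image_le.trans Finset.card_le_two)

/-- The vertices outside of `A` with a neighbour in `A`. -/
def outerBoundary (A : Finset (Fin d → Bool)) : Finset (Fin d → Bool) :=
  Finset.univ.filter fun x => x ∉ A ∧ ∃ i, flip x i ∈ A

/-- Talagrand's inequality for the complement of A: only vertices of the outer boundary of A
contribute, each at most √d. -/
lemma card_mul_le_outerBoundary (A : Finset (Fin d → Bool)) :
    A.card * (1 - density A) ≤ √d * (outerBoundary A).card := by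
  have hd : density Aᶜ = 1 - density A := by
    unfold density
    rw [Finset.card_compl, Nat.cast_sub (Finset.card_le_univ _)]
    simp only [Fintype.card_pi, Fintype.card_bool, Finset.prod_const, Finset.card_univ,
      Fintype.card_fin]
    push_cast
    rw [sub_div, div_self (by positivity)]
  have h := density_mul_le_sqrtBoundary Aᶜ
  rw [hd] at h
  have hpos : (0 : ℝ) < 2 ^ d := by positivity
  have h2 : ∑ x ∈ Aᶜ, √(outDegree Aᶜ x : ℝ) ≤ √d * (outerBoundary A).card := by
    have : ∀ x ∈ Aᶜ, √(outDegree Aᶜ x : ℝ) ≤ if ∃ i, flip x i ∈ A then √d else 0 := by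
      intro x _
      split_ifs with hx
      · apply Real.sqrt_le_sqrt
        have : outDegree Aᶜ x ≤ d := by
          simpa [outDegree] using
            Finset.card_filter_le (Finset.univ : Finset (Fin d)) fun i => flip x i ∉ Aᶜ
        exact_mod_cast this
      · have : outDegree Aᶜ x = 0 := by
          unfold outDegree
          simp only [Finset.mem_compl, not_not]
          rw [Finset.card_eq_zero, Finset.filter_eq_empty_iff]
          exact fun i _ hi => hx ⟨i, hi⟩
        simp [this]
    refine (Finset.sum_le_sum this).trans ?_
    rw [Finset.sum_ite, Finset.sum_const_zero, add_zero, Finset.sum_const, nsmul_eq_mul, mul_comm]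
    have h3 : Aᶜ.filter (fun x => ∃ i, flip x i ∈ A) = outerBoundary A := by
      ext x; simp [outerBoundary]
    rw [h3]
  unfold sqrtBoundary at h
  rw [le_div_iff₀ hpos] at h
  refine le_trans (le_of_eq ?_) (h.trans h2)
  unfold density
  field_simp
  ring

/-- A set `M` of pairwise disjoint edges of the hypercube from `A` to its complement, each written
as a pair whose first component is in `A`. -/
structure IsCutMatching (A : Finset (Fin d → Bool))
    (M : Finset ((Fin d → Bool) × (Fin d → Bool))) : Prop where
  fst_mem : ∀ e ∈ M, e.1 ∈ A
  snd_notMem : ∀ e ∈ M, e.2 ∉ A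
  adj : ∀ e ∈ M, e.2 ∈ cubeNbrs e.1
  fst_inj : ∀ e ∈ M, ∀ e' ∈ M, e.1 = e'.1 → e = e'
  snd_inj : ∀ e ∈ M, ∀ e' ∈ M, e.2 = e'.2 → e = e'

open Classical in
-- In a maximum matching M, the unmatched part A' of A has its whole outer boundary among the ends
-- of M, as any other boundary vertex would extend M. The vertex isoperimetric bound for A' then
-- bounds |M| from below.
lemma exists_isCutMatching (hd : 1 ≤ d) (A : Finset (Fin d → Bool)) {c : ℝ} (hc : 0 ≤ c)
    (hA : density A ≤ 1 - c) :
    ∃ M, IsCutMatching A M ∧ c * A.card ≤ 4 * √d * M.card := by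
  obtain ⟨M, hM, hmax⟩ := Finset.exists_max_image
    (Finset.univ.filter fun M : Finset ((Fin d → Bool) × (Fin d → Bool)) => IsCutMatching A M)
    Finset.card ⟨∅, by simp; constructor <;> simp⟩
  simp only [Finset.mem_filter, Finset.mem_univ, true_and] at hM hmax
  refine ⟨M, hM, ?_⟩
  set A' := A \ M.image Prod.fst with hA'
  have hsub : outerBoundary A' ⊆ M.image Prod.fst ∪ M.image Prod.snd := by
    intro x hx
    simp only [outerBoundary, Finset.mem_filter, Finset.mem_univ, true_and] at hx
    obtain ⟨hx, i, hi⟩ := hx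
    rw [Finset.mem_union]
    by_contra! hcon
    obtain ⟨h1, h2⟩ := hcon
    have hxA : x ∉ A := fun h => hx (Finset.mem_sdiff.2 ⟨h, h1⟩)
    rw [hA', Finset.mem_sdiff] at hi
    simp only [Finset.mem_image, not_exists, not_and] at h1 h2 hi
    have hnew : (flip x i, x) ∉ M := fun h => h2 _ h rfl
    have hins : IsCutMatching A (insert (flip x i, x) M) := by
      constructor
      · rintro e he
        rcases Finset.mem_insert.1 he with rfl | he
        exacts [hi.1, hM.fst_mem e he]
      · rintro e he
        rcases Finset.mem_insert.1 he with rfl | he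
        exacts [hxA, hM.snd_notMem e he]
      · rintro e he
        rcases Finset.mem_insert.1 he with rfl | he
        exacts [mem_cubeNbrs.2 ⟨i, flip_flip _ _⟩, hM.adj e he]
      · rintro e he e' he' h
        rcases Finset.mem_insert.1 he with rfl | he <;>
          rcases Finset.mem_insert.1 he' with rfl | he'
        exacts [rfl, (hi.2 e' he' h.symm).elim, (hi.2 e he h).elim, hM.fst_inj e he e' he' h]
      · rintro e he e' he' h
        rcases Finset.mem_insert.1 he with rfl | he <;>
          rcases Finset.mem_insert.1 he' with rfl | he'
        exacts [rfl, (h2 e' he' h.symm).elim, (h2 e he h).elim, hM.snd_inj e he e' he' h]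
    have := hmax _ hins
    rw [Finset.card_insert_of_notMem hnew] at this
    omega
  have h1 : (outerBoundary A').card ≤ 2 * M.card := by
    have := (Finset.card_le_card hsub).trans (Finset.card_union_le _ _)
    have h1 := Finset.card_image_le (s := M) (f := Prod.fst)
    have h2 := Finset.card_image_le (s := M) (f := Prod.snd)
    omega
  have h2 : A.card ≤ A'.card + M.card := by
    have : A.card ≤ A'.card + (M.image Prod.fst).card := Finset.card_le_card_sdiff_add_card
    have h1 := Finset.card_image_le (s := M) (f := Prod.fst)
    omega
  have h3 := card_mul_le_outerBoundary A'
  have h4 : density A' ≤ density A := by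
    unfold density
    gcongr
    exact Finset.sdiff_subset
  have h5 : (A'.card : ℝ) * c ≤ A'.card * (1 - density A') := by
    gcongr; linarith
  have h6 : ((outerBoundary A').card : ℝ) ≤ 2 * M.card := by exact_mod_cast h1
  have h7 : (A.card : ℝ) ≤ A'.card + M.card := by exact_mod_cast h2
  have h8 : (1 : ℝ) ≤ √d := by rw [Real.one_le_sqrt]; exact_mod_cast hd
  have h9 : c ≤ 1 := by linarith [density_nonneg A]
  have h10 := mul_le_mul_of_nonneg_left h6 (zero_le_one.trans h8)
  have h11 : (0 : ℝ) ≤ M.card := by positivity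
  nlinarith [mul_le_mul_of_nonneg_left h7 hc, mul_le_mul_of_nonneg_right h9 h11,
    mul_le_mul_of_nonneg_right h8 h11]

/-- Double counting of the edges between B and C: few vertices can send many edges into a small set.
-/
lemma mul_card_le_of_forall_le_card_inter (B C : Finset (Fin d → Bool)) {t : ℝ}
    (h : ∀ v ∈ B, t ≤ (cubeNbrs v ∩ C).card) : t * B.card ≤ d * C.card := by
  have h1 : ∑ v ∈ B, (cubeNbrs v ∩ C).card = ∑ c ∈ C, (cubeNbrs c ∩ B).card := by
    have := Finset.sum_card_bipartiteAbove_eq_sum_card_bipartiteBelow (s := B) (t := C)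
      (fun v c => c ∈ cubeNbrs v)
    unfold Finset.bipartiteAbove Finset.bipartiteBelow at this
    convert this using 4 with v hv v hv
    · ext x; simp [and_comm]
    · ext x; simp only [Finset.mem_inter, Finset.mem_filter, mem_cubeNbrs_comm (x := x)]; tauto
  have h2 : ∑ c ∈ C, (cubeNbrs c ∩ B).card ≤ C.card * d := by
    rw [← smul_eq_mul]
    exact Finset.sum_le_card_nsmul _ _ _ fun c _ =>
      (Finset.card_le_card Finset.inter_subset_left).trans (card_cubeNbrs_le c)
  have h3 : B.card • t ≤ ∑ v ∈ B, ((cubeNbrs v ∩ C).card : ℝ) := Finset.card_nsmul_le_sum _ _ _ h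
  rw [nsmul_eq_mul] at h3
  have h4 : (∑ v ∈ B, ((cubeNbrs v ∩ C).card : ℝ)) ≤ C.card * d := by
    rw [← h1] at h2; exact_mod_cast h2
  linarith

/-- Each u in G reaches at least t - 1 vertices of S other than v, and each such vertex is reached
at most twice because it has at most two common neighbours with v. -/
lemma card_mul_le_second_neighbourhood (S G : Finset (Fin d → Bool)) (v : Fin d → Bool)
    (hG : G ⊆ cubeNbrs v) {t : ℝ} (h : ∀ u ∈ G, t ≤ (cubeNbrs u ∩ S).card) :
    G.card * (t - 1) ≤ 2 * (G.biUnion fun u => cubeNbrs u ∩ S).card := by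
  set P := (G.biUnion fun u => cubeNbrs u ∩ S).erase v with hP
  have h1 : ∑ u ∈ G, (P.filter fun w => w ∈ cubeNbrs u).card =
      ∑ w ∈ P, (G.filter fun u => w ∈ cubeNbrs u).card :=
    Finset.sum_card_bipartiteAbove_eq_sum_card_bipartiteBelow (s := G) (t := P)
      (fun u w => w ∈ cubeNbrs u)
  have h2 : ∑ w ∈ P, (G.filter fun u => w ∈ cubeNbrs u).card ≤ P.card • 2 := by
    refine Finset.sum_le_card_nsmul _ _ _ fun w hw => ?_
    refine (Finset.card_le_card ?_).trans (card_common_cubeNbrs_le (Finset.ne_of_mem_erase hw))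
    intro u hu
    rw [Finset.mem_filter] at hu
    exact Finset.mem_inter.2 ⟨hG hu.1, mem_cubeNbrs_comm.1 hu.2⟩
  have h3 : G.card • (t - 1) ≤ ∑ u ∈ G, ((P.filter fun w => w ∈ cubeNbrs u).card : ℝ) := by
    refine Finset.card_nsmul_le_sum _ _ _ fun u hu => ?_
    have h4 : (cubeNbrs u ∩ S).erase v ⊆ P.filter fun w => w ∈ cubeNbrs u := by
      intro w hw
      rw [Finset.mem_erase, Finset.mem_inter] at hw
      rw [Finset.mem_filter, hP, Finset.mem_erase, Finset.mem_biUnion]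
      exact ⟨⟨hw.1, u, hu, Finset.mem_inter.2 hw.2⟩, hw.2.1⟩
    have h5 := Finset.card_le_card h4
    have h6 := Finset.pred_card_le_card_erase (s := cubeNbrs u ∩ S) (a := v)
    have h7 := h u hu
    have h8 : ((cubeNbrs u ∩ S).card : ℝ) ≤ (P.filter fun w => w ∈ cubeNbrs u).card + 1 := by
      exact_mod_cast (by omega)
    linarith
  rw [nsmul_eq_mul] at h3
  have h4 : P.card ≤ (G.biUnion fun u => cubeNbrs u ∩ S).card :=
    Finset.card_le_card (Finset.erase_subset _ _)
  have h5 : ∑ u ∈ G, ((P.filter fun w => w ∈ cubeNbrs u).card : ℝ) ≤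
      2 * (G.biUnion fun u => cubeNbrs u ∩ S).card := by
    rw [← h1, smul_eq_mul] at h2
    exact_mod_cast (by omega)
  linarith

end Neighbours

/-! ### Greedy hitting sets and fingerprints. -/

/-- If every member of a family of subsets of `S` has density at least `t` in `S`, then some
sequence of `k` elements of `S` misses at most a `(1 - t) ^ k` proportion of the family. -/
lemma exists_few_missed {V ι : Type*} [DecidableEq V] (S : Finset V) (hS : S.Nonempty)
    (I : Finset ι) (P : ι → Finset V) (hP : ∀ i ∈ I, P i ⊆ S) {t : ℝ} (ht1 : t ≤ 1)
    (ht : ∀ i ∈ I, t * S.card ≤ (P i).card) (k : ℕ) :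
    ∃ f : Fin k → V, (∀ j, f j ∈ S) ∧
      ((I.filter fun i => ∀ j, f j ∉ P i).card : ℝ) ≤ (1 - t) ^ k * I.card := by
  induction k with
  | zero => exact ⟨Fin.elim0, fun j => j.elim0, by simp⟩
  | succ k ih =>
    obtain ⟨f, hf, hle⟩ := ih
    set R := I.filter fun i => ∀ j, f j ∉ P i with hR
    have hsum : ∑ x ∈ S, (R.filter fun i => x ∈ P i).card = ∑ i ∈ R, (P i).card := by
      have := Finset.sum_card_bipartiteAbove_eq_sum_card_bipartiteBelow (s := S) (t := R)
        (fun x i => x ∈ P i)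
      unfold Finset.bipartiteAbove Finset.bipartiteBelow at this
      rw [this]
      refine Finset.sum_congr rfl fun i hi => ?_
      rw [Finset.filter_mem_eq_inter, Finset.inter_eq_right.2 (hP i (Finset.mem_filter.1 hi).1)]
    -- By averaging, some element of S lies in at least a proportion t of the members not yet hit.
    have hex : ∃ x ∈ S, t * R.card ≤ ((R.filter fun i => x ∈ P i).card : ℝ) := by
      refine Finset.exists_le_of_sum_le hS ?_
      have h1 : (∑ x ∈ S, ((R.filter fun i => x ∈ P i).card : ℝ)) = ∑ i ∈ R, ((P i).card : ℝ) := by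
        exact_mod_cast hsum
      have h2 : R.card • (t * S.card) ≤ ∑ i ∈ R, ((P i).card : ℝ) :=
        Finset.card_nsmul_le_sum _ _ _ fun i hi => ht i (Finset.mem_filter.1 hi).1
      rw [h1, Finset.sum_const, nsmul_eq_mul]
      rw [nsmul_eq_mul] at h2
      linarith
    obtain ⟨x, hx, hxt⟩ := hex
    refine ⟨Fin.cons x f, ?_, ?_⟩
    · intro j
      refine Fin.cases ?_ (fun j => ?_) j
      · simpa using hx
      · simpa using hf j
    · have h1 : (I.filter fun i => ∀ j, (Fin.cons x f : Fin (k + 1) → V) j ∉ P i) =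
          R.filter fun i => x ∉ P i := by
        ext i
        simp [hR, Fin.forall_fin_succ]
        tauto
      have h2 := Finset.card_filter_add_card_filter_not (s := R) (fun i => x ∈ P i)
      have h3 : ((R.filter fun i => x ∈ P i).card : ℝ) + ((R.filter fun i => x ∉ P i).card : ℝ) =
        R.card := by exact_mod_cast h2
      rw [h1, pow_succ']
      have h4 := mul_le_mul_of_nonneg_left hle (sub_nonneg.2 ht1)
      linarith

section Fingerprint

variable {d : ℕ}

/-- The vertices that are in `Y` or have at least `L` neighbours in `Y`. -/
def robustNbhd (L : ℕ) (Y : Finset (Fin d → Bool)) : Finset (Fin d → Bool) :=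
  Finset.univ.filter fun v => v ∈ Y ∨ L ≤ (cubeNbrs v ∩ Y).card

open Classical in
/-- The sets that are contained in the neighbourhood of a sequence of `k` vertices. -/
noncomputable def fingerprints (d k : ℕ) : Finset (Finset (Fin d → Bool)) :=
  Finset.univ.biUnion fun f : Fin k → Fin d → Bool =>
    (Finset.univ.biUnion fun j => cubeNbrs (f j)).powerset

/-- There are 2^(dk) sequences, and each has at most dk neighbours to choose from. -/
lemma card_fingerprints_le (d k : ℕ) : (fingerprints d k).card ≤ 2 ^ (2 * d * k) := by
  classical
  refine (Finset.card_biUnion_le_card_mul _ _ (2 ^ (d * k)) fun f _ => ?_).trans (le_of_eq ?_)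
  · rw [Finset.card_powerset]
    refine Nat.pow_le_pow_right (by norm_num) ?_
    refine (Finset.card_biUnion_le_card_mul _ _ d fun j _ => card_cubeNbrs_le _).trans ?_
    simp [mul_comm]
  · simp only [Finset.card_univ, Fintype.card_pi, Fintype.card_bool, Finset.prod_const,
      Fintype.card_fin]
    ring

/-- For almost every v, its good neighbours are split into L groups, each with order d²/L second
neighbours in S. A sequence that hits all L of these sets puts one vertex of each group into Y,
hence L neighbours of v. -/
lemma exists_fingerprint (hd : 1 ≤ d) {S T : Finset (Fin d → Bool)} {α : ℝ} (hα : 0 < α)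
    (hα1 : α ≤ 1) {L : ℕ} (hL : 1 ≤ L) (hLd : 8 * L ≤ α * d)
    (h : ∀ v ∈ S, α * d ≤ (cubeNbrs v ∩ (S ∪ T)).card) (hT : 10 / α ^ 2 * T.card < S.card) :
    α ^ 2 / (64 * L) * d ^ 2 ≤ S.card ∧ ∀ k, ∃ Y ∈ fingerprints d k, Y ⊆ S ∧
      ((S \ robustNbhd L Y).card : ℝ) ≤
        10 / α ^ 2 * T.card + L * S.card * (1 - α ^ 2 / (64 * L) * d ^ 2 / S.card) ^ k := by
  classical
  have hd0 : (0 : ℝ) < d := by exact_mod_cast hd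
  have hL0 : (1 : ℝ) ≤ L := by exact_mod_cast hL
  -- Double counting gives |S \ S₀| ≤ (2/α)|T| and |S₀ \ S₁| ≤ (4/α)|S \ S₀|, whence 10/α² in total.
  set S₀ := S.filter fun v => α * d / 2 ≤ (cubeNbrs v ∩ S).card with hS₀
  set S₁ := S.filter fun v => α * d / 4 ≤ (cubeNbrs v ∩ S₀).card with hS₁
  set D := α ^ 2 / (64 * L) * d ^ 2 with hD
  have hb0 : α / 2 * (S \ S₀).card ≤ T.card := by
    have := mul_card_le_of_forall_le_card_inter (S \ S₀) T (t := α * d / 2) fun v hv => by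
      rw [Finset.mem_sdiff, hS₀, Finset.mem_filter, not_and, not_le] at hv
      have h1 := hv.2 hv.1
      have h2 := h v hv.1
      have h3 : (cubeNbrs v ∩ (S ∪ T)).card ≤ (cubeNbrs v ∩ S).card + (cubeNbrs v ∩ T).card := by
        rw [Finset.inter_union_distrib_left]; exact Finset.card_union_le _ _
      have h4 : ((cubeNbrs v ∩ (S ∪ T)).card : ℝ) ≤
        (cubeNbrs v ∩ S).card + (cubeNbrs v ∩ T).card := by exact_mod_cast h3
      linarith
    refine le_of_mul_le_mul_left (le_trans (le_of_eq ?_) this) hd0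
    ring
  have hb1 : α / 4 * (S₀ \ S₁).card ≤ (S \ S₀).card := by
    have := mul_card_le_of_forall_le_card_inter (S₀ \ S₁) (S \ S₀) (t := α * d / 4) fun v hv => by
      obtain ⟨hv0, hv1⟩ := Finset.mem_sdiff.1 hv
      obtain ⟨hvS, h2⟩ := Finset.mem_filter.1 hv0
      rw [hS₁, Finset.mem_filter, not_and, not_le] at hv1
      have h1 := hv1 hvS
      have h3 : (cubeNbrs v ∩ S).card ≤ (cubeNbrs v ∩ S₀).card + (cubeNbrs v ∩ (S \ S₀)).card := by
        refine (Finset.card_le_card ?_).trans (Finset.card_union_le _ _)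
        intro x; simp only [Finset.mem_inter, Finset.mem_union, Finset.mem_sdiff]; tauto
      have h4 : ((cubeNbrs v ∩ S).card : ℝ) ≤
        (cubeNbrs v ∩ S₀).card + (cubeNbrs v ∩ (S \ S₀)).card := by exact_mod_cast h3
      linarith
    refine le_of_mul_le_mul_left (le_trans (le_of_eq ?_) this) hd0
    ring
  have hb : ((S \ S₁).card : ℝ) ≤ 10 / α ^ 2 * T.card := by
    have h1 : (S \ S₁).card ≤ (S \ S₀).card + (S₀ \ S₁).card := by
      refine (Finset.card_le_card ?_).trans (Finset.card_union_le _ _)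
      intro x; simp only [Finset.mem_union, Finset.mem_sdiff]; tauto
    have h2 : ((S \ S₁).card : ℝ) ≤ (S \ S₀).card + (S₀ \ S₁).card := by exact_mod_cast h1
    rw [div_mul_eq_mul_div, le_div_iff₀ (by positivity)]
    have h3 : α ^ 2 * ((S \ S₀).card : ℝ) ≤ 2 * T.card := by
      have h4 : α ^ 2 * ((S \ S₀).card : ℝ) ≤ α * (S \ S₀).card := by
        gcongr; nlinarith
      linarith
    have h5 := mul_le_mul_of_nonneg_left hb1 hα.le
    nlinarith [mul_le_mul_of_nonneg_left h2 (sq_nonneg α)]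
  -- The group size: L groups fit into αd/4 neighbours, and `hLd` ensures that rounding down loses
  -- at most a factor 2.
  set r := ⌊α * d / (4 * L)⌋₊ with hr
  have hr1 : (r : ℝ) ≤ α * d / (4 * L) := Nat.floor_le (by positivity)
  have hr2 : α * d / (8 * L) ≤ r := by
    have h1 := Nat.lt_floor_add_one (α * d / (4 * L))
    rw [← hr] at h1
    have h2 : α * d / (4 * L) = 2 * (α * d / (8 * L)) := by field_simp; norm_num
    have h3 : 1 ≤ α * d / (8 * L) := by rw [one_le_div (by positivity)]; exact hLd
    linarith
  have hgrp : ∀ v ∈ S₁, ∃ e : Fin L × Fin r → Fin d → Bool, Function.Injective e ∧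
      ∀ x, e x ∈ cubeNbrs v ∩ S₀ := by
    intro v hv
    have h1 := (Finset.mem_filter.1 hv).2
    have h2 : L * r ≤ (cubeNbrs v ∩ S₀).card := by
      have : (L : ℝ) * r ≤ (cubeNbrs v ∩ S₀).card := by
        refine le_trans ?_ h1
        refine (mul_le_mul_of_nonneg_left hr1 (by positivity)).trans (le_of_eq ?_)
        field_simp
      exact_mod_cast this
    obtain ⟨e⟩ := Function.Embedding.nonempty_of_card_le (α := Fin L × Fin r)
      (β := {x // x ∈ cubeNbrs v ∩ S₀}) (by simpa [-Finset.mem_inter] using h2)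
    exact ⟨fun x => (e x).1, Subtype.val_injective.comp e.injective, fun x => (e x).2⟩
  choose! e he_inj he_mem using hgrp
  let G : (Fin d → Bool) × Fin L → Finset (Fin d → Bool) := fun i =>
    Finset.univ.image fun j => e i.1 (i.2, j)
  let P : (Fin d → Bool) × Fin L → Finset (Fin d → Bool) := fun i =>
    (G i).biUnion fun u => cubeNbrs u ∩ S
  have hGmem : ∀ i ∈ S₁ ×ˢ (Finset.univ : Finset (Fin L)), ∀ u ∈ G i, u ∈ cubeNbrs i.1 ∩ S₀ := by
    intro i hi u hu
    obtain ⟨j, -, rfl⟩ := Finset.mem_image.1 hu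
    exact he_mem i.1 (Finset.mem_product.1 hi).1 _
  have hPS : ∀ i, P i ⊆ S := fun i => Finset.biUnion_subset.2 fun u _ => Finset.inter_subset_right
  have hPcard : ∀ i ∈ S₁ ×ˢ (Finset.univ : Finset (Fin L)), D ≤ (P i).card := by
    intro i hi
    have hGcard : (G i).card = r := by
      rw [Finset.card_image_of_injective]
      · simp
      · intro a b hab
        have := he_inj i.1 (Finset.mem_product.1 hi).1 hab
        simpa using this
    have h1 := card_mul_le_second_neighbourhood S (G i) i.1
      (fun u hu => (Finset.mem_inter.1 (hGmem i hi u hu)).1) (t := α * d / 2)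
      (fun u hu => (Finset.mem_filter.1 (Finset.mem_inter.1 (hGmem i hi u hu)).2).2)
    rw [hGcard] at h1
    have h2 : α * d / 4 ≤ α * d / 2 - 1 := by linarith
    have h3 : α * d / (8 * L) * (α * d / 4) ≤ r * (α * d / 2 - 1) := by gcongr
    have h4 : D = α * d / (8 * L) * (α * d / 4) / 2 := by
      rw [hD]; field_simp; norm_num
    rw [h4]
    linarith
  have hS1 : S₁.Nonempty := by
    by_contra hcon
    rw [Finset.not_nonempty_iff_eq_empty] at hcon
    rw [hcon, Finset.sdiff_empty] at hb
    linarith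
  have hSn : S.Nonempty := hS1.mono (Finset.filter_subset _ _)
  have hS0 : (0 : ℝ) < S.card := by exact_mod_cast hSn.card_pos
  have hDS : D ≤ S.card := by
    obtain ⟨v, hv⟩ := hS1
    refine (hPcard (v, ⟨0, hL⟩) (by simp [hv])).trans ?_
    exact_mod_cast Finset.card_le_card (hPS _)
  refine ⟨hDS, fun k => ?_⟩
  obtain ⟨f, hf, hmiss⟩ := exists_few_missed S hSn (S₁ ×ˢ (Finset.univ : Finset (Fin L))) P
    (fun i _ => hPS i) (t := D / S.card) ((div_le_one hS0).2 hDS)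
    (fun i hi => by rw [div_mul_cancel₀ _ hS0.ne']; exact hPcard i hi) k
  set Y := S ∩ Finset.univ.biUnion fun j => cubeNbrs (f j) with hY
  refine ⟨Y, ?_, Finset.inter_subset_left, ?_⟩
  · simp only [fingerprints, Finset.mem_biUnion, Finset.mem_univ, true_and, Finset.mem_powerset]
    exact ⟨f, Finset.inter_subset_right⟩
  set R := (S₁ ×ˢ (Finset.univ : Finset (Fin L))).filter fun i => ∀ j, f j ∉ P i with hR
  have hsub : S \ robustNbhd L Y ⊆ (S \ S₁) ∪ R.image Prod.fst := by
    intro v hv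
    rw [Finset.mem_sdiff] at hv
    rw [Finset.mem_union, Finset.mem_sdiff]
    by_cases hv1 : v ∈ S₁
    swap
    · exact Or.inl ⟨hv.1, hv1⟩
    right
    by_contra hcon
    apply hv.2
    have hhit : ∀ l : Fin L, ∃ u ∈ G (v, l), u ∈ Y := by
      intro l
      have h1 : (v, l) ∉ R := fun h1 => hcon (Finset.mem_image.2 ⟨_, h1, rfl⟩)
      rw [hR, Finset.mem_filter] at h1
      push Not at h1
      obtain ⟨j, hj⟩ := h1 (by simp [hv1])
      obtain ⟨u, hu, hju⟩ := Finset.mem_biUnion.1 hj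
      refine ⟨u, hu, ?_⟩
      rw [hY, Finset.mem_inter, Finset.mem_biUnion]
      have h2 := hGmem (v, l) (by simp [hv1]) u hu
      refine ⟨(Finset.mem_filter.1 (Finset.mem_inter.1 h2).2).1, j, Finset.mem_univ _, ?_⟩
      exact mem_cubeNbrs_comm.1 (Finset.mem_inter.1 hju).1
    choose g hgG hgY using hhit
    have hginj : Function.Injective g := by
      intro a b hab
      obtain ⟨i, -, hi⟩ := Finset.mem_image.1 (hgG a)
      obtain ⟨j, -, hj⟩ := Finset.mem_image.1 (hgG b)
      have : e v (a, i) = e v (b, j) := by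
        simp only at hi hj
        rw [hi, hj, hab]
      exact (Prod.ext_iff.1 (he_inj v hv1 this)).1
    simp only [robustNbhd, Finset.mem_filter, Finset.mem_univ, true_and]
    right
    have h3 : Finset.univ.image g ⊆ cubeNbrs v ∩ Y := by
      intro u hu
      obtain ⟨l, -, rfl⟩ := Finset.mem_image.1 hu
      exact Finset.mem_inter.2
        ⟨(Finset.mem_inter.1 (hGmem (v, l) (by simp [hv1]) _ (hgG l))).1, hgY l⟩
    have h4 := Finset.card_le_card h3
    rwa [Finset.card_image_of_injective _ hginj, Finset.card_univ, Fintype.card_fin] at h4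
  have h1 : (S \ robustNbhd L Y).card ≤ (S \ S₁).card + R.card :=
    (Finset.card_le_card hsub).trans ((Finset.card_union_le _ _).trans
      (Nat.add_le_add_left Finset.card_image_le _))
  have h2 : ((S \ robustNbhd L Y).card : ℝ) ≤ (S \ S₁).card + R.card := by exact_mod_cast h1
  have h3 : ((S₁ ×ˢ (Finset.univ : Finset (Fin L))).card : ℝ) ≤ S.card * L := by
    rw [Finset.card_product, Finset.card_univ, Fintype.card_fin]
    have : S₁.card ≤ S.card := Finset.card_filter_le _ _
    push_cast
    gcongr
  have h4 : (0 : ℝ) ≤ (1 - D / S.card) ^ k := pow_nonneg (sub_nonneg.2 ((div_le_one hS0).2 hDS)) _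
  have h5 := mul_le_mul_of_nonneg_left h3 h4
  linarith

end Fingerprint

/-! ### Unlikely events attached to a fixed fingerprint. -/

section RareEvents

variable {d : ℕ}

/-- In the configuration `ω`, every open edge that starts in `S` ends in `S ∪ T`. -/
structure IsSealed (ω : Set (Fin d → Bool) × Set (Sym2 (Fin d → Bool)))
    (S T : Finset (Fin d → Bool)) : Prop where
  subset : ∀ a ∈ S, a ∈ ω.1
  mem_union : ∀ a ∈ S, ∀ b ∈ cubeNbrs a, b ∈ ω.1 → s(a, b) ∈ ω.2 → b ∈ S ∪ T

lemma mk_mem_edgeSet {a b : Fin d → Bool} (h : b ∈ cubeNbrs a) : s(a, b) ∈ (hypercube d).edgeSet := by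
  rw [SimpleGraph.mem_edgeSet, hypercube_adj_iff]; exact h

lemma measureReal_iInter_eq_prod (p q : unitInterval) {ι : Type*} [DecidableEq ι] (M : Finset ι)
    (U : ι → Finset (Fin d → Bool)) (F : ι → Finset (Sym2 (Fin d → Bool)))
    (hF : ∀ e ∈ M, (F e : Set (Sym2 (Fin d → Bool))) ⊆ (hypercube d).edgeSet)
    (hU : ∀ e ∈ M, ∀ e' ∈ M, e ≠ e' → Disjoint (U e) (U e'))
    (hF' : ∀ e ∈ M, ∀ e' ∈ M, e ≠ e' → Disjoint (F e) (F e')) :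
    (mixedLaw (hypercube d) p q).real (⋂ e ∈ M, {ω | (U e : Set (Fin d → Bool)) ⊆ ω.1 ∧
      (F e : Set (Sym2 (Fin d → Bool))) ⊆ ω.2}) =
      ∏ e ∈ M, (p : ℝ) ^ (U e).card * (q : ℝ) ^ (F e).card := by
  classical
  have : (⋂ e ∈ M, {ω : Set (Fin d → Bool) × Set (Sym2 (Fin d → Bool)) |
      (U e : Set (Fin d → Bool)) ⊆ ω.1 ∧ (F e : Set (Sym2 (Fin d → Bool))) ⊆ ω.2}) =
      {ω | ((M.biUnion U : Finset _) : Set (Fin d → Bool)) ⊆ ω.1 ∧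
        ((M.biUnion F : Finset _) : Set (Sym2 (Fin d → Bool))) ⊆ ω.2} := by
    ext ω
    simp only [Set.mem_iInter, Set.mem_ofPred_eq, Finset.coe_biUnion, Set.iUnion_subset_iff,
      Finset.mem_coe]
    exact ⟨fun h => ⟨fun i hi => (h i hi).1, fun i hi => (h i hi).2⟩,
      fun h i hi => ⟨h.1 i hi, h.2 i hi⟩⟩
  rw [this, mixedLaw_real_superset, Finset.card_biUnion hU, Finset.card_biUnion hF',
    ← Finset.prod_pow_eq_pow_sum, ← Finset.prod_pow_eq_pow_sum, Finset.prod_mul_distrib]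
  rw [Finset.coe_biUnion]
  exact Set.iUnion₂_subset hF

/-- With overwhelming probability, a positive proportion of the vertices is retained. -/
lemma measureReal_few_vertices_le (p q : unitInterval) :
    (mixedLaw (hypercube d) p q).real {ω | (ω.1.ncard : ℝ) ≤ p * 2 ^ d / 4} ≤
      Real.exp (-(p * 2 ^ d / 4)) := by
  classical
  have h := measureReal_card_le_le_exp (mixedLaw (hypercube d) p q) Finset.univ
    (fun v : Fin d → Bool => {ω | (({v} : Finset (Fin d → Bool)) : Set (Fin d → Bool)) ⊆ ω.1 ∧
      ((∅ : Finset (Sym2 (Fin d → Bool))) : Set (Sym2 (Fin d → Bool))) ⊆ ω.2})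
    (fun v => measurableSet_superset _ _)
    (fun v => (p : ℝ) ^ ({v} : Finset (Fin d → Bool)).card *
      (q : ℝ) ^ (∅ : Finset (Sym2 (Fin d → Bool))).card) (r := p) (by simp)
    (fun J _ => measureReal_iInter_eq_prod p q J (fun v => {v}) (fun _ => ∅) (by simp)
      (fun e _ e' _ h => by simpa using h) (by simp))
  have hset : ∀ ω : Set (Fin d → Bool) × Set (Sym2 (Fin d → Bool)), ω.1.ncard =
      (Finset.univ.filter fun v => ω ∈ {ω : Set (Fin d → Bool) × Set (Sym2 (Fin d → Bool)) |
        (({v} : Finset (Fin d → Bool)) : Set (Fin d → Bool)) ⊆ ω.1 ∧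
        ((∅ : Finset (Sym2 (Fin d → Bool))) : Set (Sym2 (Fin d → Bool))) ⊆ ω.2}).card := by
    intro ω
    rw [← Set.ncard_coe_finset]
    congr 1
    ext v; simp
  simp only [hset]
  convert h using 4 <;> simp

open Classical in
/-- If the robust neighbourhood of `Y` is not too large then, outside of an event of small
probability, no sealed set `S ⊇ Y` is well approximated by it. -/
lemma exists_rare_event_of_density_le (hd : 1 ≤ d) (p q : unitInterval) {L : ℕ} (hL : 1 ≤ L)
    (Y : Finset (Fin d → Bool)) {c : ℝ} (hc : 0 ≤ c) (hA : density (robustNbhd L Y) ≤ 1 - c) :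
    ∃ B : Set (Set (Fin d → Bool) × Set (Sym2 (Fin d → Bool))),
      (mixedLaw (hypercube d) p q).real B ≤
        Real.exp (-((p : ℝ) ^ 2 * (q : ℝ) ^ 2 * c * (robustNbhd L Y).card / (16 * √d))) ∧
      ∀ ω ∉ B, ∀ S T, IsSealed ω S T → Y ⊆ S →
        (p : ℝ) ^ 2 * (q : ℝ) ^ 2 * c * (robustNbhd L Y).card / (16 * √d) <
          2 * T.card + (S \ robustNbhd L Y).card := by
  set A := robustNbhd L Y with hAdef
  obtain ⟨M, hM, hMcard⟩ := exists_isCutMatching hd A hc hA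
  have hYA : ∀ y ∈ Y, y ∈ A := fun y hy => by simp [hAdef, robustNbhd, hy]
  -- Each vertex of A outside Y gets an anchor in Y. Through an open edge from its anchor, a
  -- retained vertex is forced into S ∪ T.
  have hanchor : ∀ a, ∃ y, a ∈ A → a ∉ Y → y ∈ Y ∧ y ∈ cubeNbrs a := by
    intro a
    by_cases h : a ∈ A ∧ a ∉ Y
    · have h1 : L ≤ (cubeNbrs a ∩ Y).card := by
        have := h.1
        simp only [hAdef, robustNbhd, Finset.mem_filter, Finset.mem_univ, true_and] at this
        exact this.resolve_left h.2
      obtain ⟨y, hy⟩ := Finset.card_pos.1 (hL.trans h1)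
      exact ⟨y, fun _ _ => ⟨(Finset.mem_inter.1 hy).2, (Finset.mem_inter.1 hy).1⟩⟩
    · exact ⟨a, fun h1 h2 => (h ⟨h1, h2⟩).elim⟩
  choose y hy using hanchor
  -- Anchors are left out of the vertices required to be retained: they may be shared by several
  -- matching edges, which would destroy independence, and Y ⊆ S already retains them.
  let U : (Fin d → Bool) × (Fin d → Bool) → Finset (Fin d → Bool) := fun e => {e.1, e.2}
  let F : (Fin d → Bool) × (Fin d → Bool) → Finset (Sym2 (Fin d → Bool)) := fun e =>
    if e.1 ∈ Y then {s(e.1, e.2)} else {s(e.1, e.2), s(y e.1, e.1)}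
  have hFmem : ∀ e f, f ∈ F e ↔ f = s(e.1, e.2) ∨ (e.1 ∉ Y ∧ f = s(y e.1, e.1)) := by
    intro e f
    simp only [F]
    split_ifs with h <;> simp [h]
  have hF : ∀ e ∈ M, (F e : Set (Sym2 (Fin d → Bool))) ⊆ (hypercube d).edgeSet := by
    intro e he f hf
    rcases (hFmem e f).1 hf with rfl | ⟨h, rfl⟩
    · exact mk_mem_edgeSet (hM.adj e he)
    · exact mk_mem_edgeSet (mem_cubeNbrs_comm.1 (hy _ (hM.fst_mem e he) h).2)
  have hU : ∀ e ∈ M, ∀ e' ∈ M, e ≠ e' → Disjoint (U e) (U e') := by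
    intro e he e' he' hne
    rw [Finset.disjoint_left]
    intro x hx hx'
    simp only [U, Finset.mem_insert, Finset.mem_singleton] at hx hx'
    rcases hx with rfl | rfl <;> rcases hx' with h | h
    · exact hne (hM.fst_inj e he e' he' h)
    · exact hM.snd_notMem e' he' (h ▸ hM.fst_mem e he)
    · exact hM.snd_notMem e he (h ▸ hM.fst_mem e' he')
    · exact hne (hM.snd_inj e he e' he' h)
  have hF' : ∀ e ∈ M, ∀ e' ∈ M, e ≠ e' → Disjoint (F e) (F e') := by
    intro e he e' he' hne
    rw [Finset.disjoint_left]
    intro f hf hf'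
    rw [hFmem] at hf hf'
    rcases hf with rfl | ⟨h, rfl⟩ <;> rcases hf' with h' | ⟨h', h''⟩
    · rcases Sym2.eq_iff.1 h' with h | h
      · exact hne (hM.fst_inj e he e' he' h.1)
      · exact hM.snd_notMem e he (h.2 ▸ hM.fst_mem e' he')
    · have h1 := hM.fst_mem e' he'
      rcases Sym2.eq_iff.1 h'' with h | h
      · exact hM.snd_notMem e he (h.2 ▸ h1)
      · exact hM.snd_notMem e he (h.2 ▸ hYA _ (hy _ h1 h').1)
    · have h1 := hM.fst_mem e he
      rcases Sym2.eq_iff.1 h' with h2 | h2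
      · exact hM.snd_notMem e' he' (h2.2 ▸ h1)
      · exact hM.snd_notMem e' he' (h2.1 ▸ hYA _ (hy _ h1 h).1)
    · rcases Sym2.eq_iff.1 h'' with h2 | h2
      · exact hne (hM.fst_inj e he e' he' h2.2)
      · exact h' (h2.1 ▸ (hy _ (hM.fst_mem e he) h).1)
  let E : (Fin d → Bool) × (Fin d → Bool) → Set (Set (Fin d → Bool) × Set (Sym2 (Fin d → Bool))) :=
    fun e => {ω | (U e : Set (Fin d → Bool)) ⊆ ω.1 ∧ (F e : Set (Sym2 (Fin d → Bool))) ⊆ ω.2}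
  have hprob := measureReal_card_le_le_exp (mixedLaw (hypercube d) p q) M E
    (fun e => measurableSet_superset _ _)
    (fun e => (p : ℝ) ^ (U e).card * (q : ℝ) ^ (F e).card) (r := (p : ℝ) ^ 2 * (q : ℝ) ^ 2)
    (fun e _ => by
      have h1 : (U e).card ≤ 2 := Finset.card_le_two
      have h2 : (F e).card ≤ 2 := by
        simp only [F]
        split_ifs
        · simp
        · exact Finset.card_le_two
      exact mul_le_mul (pow_le_pow_of_le_one p.2.1 p.2.2 h1) (pow_le_pow_of_le_one q.2.1 q.2.2 h2)
        (pow_nonneg q.2.1 _) (pow_nonneg p.2.1 _))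
    (fun J hJ => measureReal_iInter_eq_prod p q J U F (fun e he => hF e (hJ he))
      (fun e he e' he' => hU e (hJ he) e' (hJ he')) (fun e he e' he' => hF' e (hJ he) e' (hJ he')))
  have hs : (0 : ℝ) < √d := Real.sqrt_pos.2 (by exact_mod_cast hd)
  have hle : (p : ℝ) ^ 2 * (q : ℝ) ^ 2 * c * A.card / (16 * √d) ≤
      (p : ℝ) ^ 2 * (q : ℝ) ^ 2 * M.card / 4 := by
    rw [div_le_div_iff₀ (by positivity) (by norm_num)]
    have h1 : (0 : ℝ) ≤ (p : ℝ) ^ 2 * (q : ℝ) ^ 2 := by positivity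
    have := mul_le_mul_of_nonneg_left hMcard h1
    nlinarith
  refine ⟨_, hprob.trans (Real.exp_le_exp.2 (neg_le_neg hle)), ?_⟩
  intro ω hω S T hST hYS
  rw [Set.mem_ofPred_eq, not_le] at hω
  refine (hle.trans_lt hω).trans_le ?_
  have hsub : M.filter (fun e => ω ∈ E e) ⊆ (M.filter fun e => e.1 ∈ T) ∪
      (M.filter fun e => e.2 ∈ T) ∪ (M.filter fun e => e.2 ∈ S \ A) := by
    intro e he
    obtain ⟨heM, heU, heF⟩ := Finset.mem_filter.1 he
    simp only [Finset.mem_union, Finset.mem_filter, heM, true_and, Finset.mem_sdiff]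
    have h1 : e.1 ∈ ω.1 := heU (by simp [U])
    have h2 : e.2 ∈ ω.1 := heU (by simp [U])
    have h3 : e.1 ∈ S ∪ T := by
      by_cases h : e.1 ∈ Y
      · exact Finset.mem_union_left _ (hYS h)
      · have h4 := hy _ (hM.fst_mem e heM) h
        exact hST.mem_union _ (hYS h4.1) _ (mem_cubeNbrs_comm.1 h4.2) h1
          (heF ((hFmem e _).2 (Or.inr ⟨h, rfl⟩)))
    rcases Finset.mem_union.1 h3 with h3 | h3
    · have h4 := hST.mem_union _ h3 _ (hM.adj e heM) h2 (heF ((hFmem e _).2 (Or.inl rfl)))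
      rcases Finset.mem_union.1 h4 with h4 | h4
      · exact Or.inr ⟨h4, hM.snd_notMem e heM⟩
      · exact Or.inl (Or.inr h4)
    · exact Or.inl (Or.inl h3)
  have hcard : ∀ X : Finset (Fin d → Bool), (M.filter fun e => e.1 ∈ X).card ≤ X.card := fun X =>
    Finset.card_le_card_of_injOn Prod.fst (fun e he => (Finset.mem_filter.1 he).2)
      fun e he e' he' => hM.fst_inj e (Finset.mem_filter.1 he).1 e' (Finset.mem_filter.1 he').1
  have hcard' : ∀ X : Finset (Fin d → Bool), (M.filter fun e => e.2 ∈ X).card ≤ X.card := fun X =>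
    Finset.card_le_card_of_injOn Prod.snd (fun e he => (Finset.mem_filter.1 he).2)
      fun e he e' he' => hM.snd_inj e (Finset.mem_filter.1 he).1 e' (Finset.mem_filter.1 he').1
  have h1 := Finset.card_le_card hsub
  have h2 := Finset.card_union_le ((M.filter fun e => e.1 ∈ T) ∪ (M.filter fun e => e.2 ∈ T))
    (M.filter fun e => e.2 ∈ S \ A)
  have h3 := Finset.card_union_le (M.filter fun e => e.1 ∈ T) (M.filter fun e => e.2 ∈ T)
  have h4 := hcard T
  have h5 := hcard' T
  have h6 := hcard' (S \ A)
  have h7 : ((M.filter fun e => ω ∈ E e).card : ℝ) ≤ 2 * T.card + (S \ A).card := by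
    exact_mod_cast (by omega)
  refine le_of_eq_of_le ?_ h7
  congr!

open Classical in
/-- Outside of an event of small probability, every sealed set `S ⊇ Y` contains almost all
retained vertices of the robust neighbourhood of `Y`. -/
lemma exists_rare_event_few_missed (p q : unitInterval) {n L : ℕ} (hL : (1 - q : ℝ) ^ L ≤ 1 / 8)
    (Y : Finset (Fin d → Bool)) :
    ∃ B : Set (Set (Fin d → Bool) × Set (Sym2 (Fin d → Bool))),
      (mixedLaw (hypercube d) p q).real B ≤ (1 / 4) ^ 2 ^ d ∧
      ∀ ω ∉ B, ∀ S T, IsSealed ω S T → Y ⊆ S →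
        n * (ω.1.ncard : ℝ) ≤ n * (S.card + T.card + (robustNbhd (n * L) Y)ᶜ.card) + 2 ^ d := by
  set A := robustNbhd (n * L) Y with hA
  let F : (Fin d → Bool) → Finset (Sym2 (Fin d → Bool)) := fun v =>
    (cubeNbrs v ∩ Y).image fun y => s(v, y)
  have hFmem : ∀ v f, f ∈ F v ↔ ∃ y ∈ cubeNbrs v ∩ Y, s(v, y) = f := fun v f => Finset.mem_image
  have hFsub : ∀ v, (F v : Set (Sym2 (Fin d → Bool))) ⊆ (hypercube d).edgeSet := by
    intro v f hf
    obtain ⟨y, hy, rfl⟩ := (hFmem v f).1 hf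
    exact mk_mem_edgeSet (Finset.mem_inter.1 hy).1
  have hFcard : ∀ v ∈ A \ Y, n * L ≤ (F v).card := by
    intro v hv
    rw [Finset.mem_sdiff] at hv
    have h1 : n * L ≤ (cubeNbrs v ∩ Y).card := by
      have := hv.1
      simp only [hA, robustNbhd, Finset.mem_filter, Finset.mem_univ, true_and] at this
      exact this.resolve_left hv.2
    refine h1.trans (Finset.card_image_of_injective _ fun a b hab => ?_).ge
    exact Sym2.congr_right.1 hab
  have hFdisj : ∀ v ∈ A \ Y, ∀ v' ∈ A \ Y, v ≠ v' → Disjoint (F v) (F v') := by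
    intro v hv v' hv' hne
    rw [Finset.disjoint_left]
    intro f hf hf'
    obtain ⟨y, hy, rfl⟩ := (hFmem v f).1 hf
    obtain ⟨y', hy', h⟩ := (hFmem v' _).1 hf'
    rcases Sym2.eq_iff.1 h with h | h
    · exact hne h.1.symm
    · exact (Finset.mem_sdiff.1 hv').2 (h.1 ▸ (Finset.mem_inter.1 hy).2)
  let R : Set (Fin d → Bool) × Set (Sym2 (Fin d → Bool)) → Finset (Fin d → Bool) := fun ω =>
    (A \ Y).filter fun v => ∀ f ∈ F v, f ∉ ω.2
  -- A union bound over at most 2^(2^d) sets J of exceptional vertices. Each J requires at least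
  -- L·2^d distinct edges to be closed, which has probability at most (1/8)^(2^d).
  let 𝒥 := (A \ Y).powerset.filter fun J => 2 ^ d ≤ n * J.card
  have hq0 : (0 : ℝ) ≤ 1 - q := sub_nonneg.2 q.2.2
  have hq1 : (1 - q : ℝ) ≤ 1 := by linarith [q.2.1]
  refine ⟨{ω | 2 ^ d ≤ n * (R ω).card}, ?_, ?_⟩
  · have hsub : {ω | 2 ^ d ≤ n * (R ω).card} ⊆ ⋃ J ∈ 𝒥, {ω | ∀ f ∈ J.biUnion F, f ∉ ω.2} := by
      intro ω hω
      refine Set.mem_iUnion₂.2 ⟨R ω, ?_, ?_⟩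
      · exact Finset.mem_filter.2 ⟨Finset.mem_powerset.2 (Finset.filter_subset _ _), hω⟩
      · intro f hf
        obtain ⟨v, hv, hf⟩ := Finset.mem_biUnion.1 hf
        exact (Finset.mem_filter.1 hv).2 f hf
    refine (measureReal_mono hsub (measure_ne_top _ _)).trans ((measureReal_biUnion_finset_le _ _).trans ?_)
    have hJ : ∀ J ∈ 𝒥, (mixedLaw (hypercube d) p q).real {ω | ∀ f ∈ J.biUnion F, f ∉ ω.2} ≤
        (1 / 8) ^ 2 ^ d := by
      intro J hJ
      obtain ⟨hJs, hJc⟩ := Finset.mem_filter.1 hJ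
      rw [Finset.mem_powerset] at hJs
      rw [mixedLaw_real_disjoint]
      · rw [Finset.card_biUnion fun v hv v' hv' => hFdisj v (hJs hv) v' (hJs hv')]
        have h1 : J.card • (n * L) ≤ ∑ v ∈ J, (F v).card :=
          Finset.card_nsmul_le_sum _ _ _ fun v hv => hFcard v (hJs hv)
        have h2 : L * 2 ^ d ≤ ∑ v ∈ J, (F v).card := by
          refine le_trans ?_ h1
          rw [smul_eq_mul]
          calc L * 2 ^ d ≤ L * (n * J.card) := Nat.mul_le_mul_left _ hJc
            _ = _ := by ring
        refine (pow_le_pow_of_le_one hq0 hq1 h2).trans ?_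
        rw [pow_mul]
        exact pow_le_pow_left₀ (pow_nonneg hq0 _) hL _
      · rw [Finset.coe_biUnion]
        exact Set.iUnion₂_subset fun v _ => hFsub v
    refine (Finset.sum_le_card_nsmul _ _ _ hJ).trans ?_
    rw [nsmul_eq_mul]
    have h1 : 𝒥.card ≤ 2 ^ 2 ^ d := by
      refine (Finset.card_filter_le _ _).trans ?_
      rw [Finset.card_powerset]
      refine Nat.pow_le_pow_right (by norm_num) ((Finset.card_le_univ _).trans (by simp))
    have h2 : (𝒥.card : ℝ) ≤ 2 ^ 2 ^ d := by exact_mod_cast h1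
    calc _ ≤ (2 : ℝ) ^ 2 ^ d * (1 / 8) ^ 2 ^ d := by gcongr
      _ = _ := by rw [← mul_pow]; norm_num
  · intro ω hω S T hST hYS
    rw [Set.mem_ofPred_eq, not_le] at hω
    have hsub : ω.1 ⊆ ((S ∪ T ∪ Aᶜ ∪ R ω : Finset (Fin d → Bool)) : Set (Fin d → Bool)) := by
      intro v hv
      rw [Finset.mem_coe]
      by_contra hcon
      simp only [Finset.mem_union, not_or, Finset.mem_compl, not_not] at hcon
      obtain ⟨⟨⟨hS, hT⟩, hvA⟩, hR⟩ := hcon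
      have hvY : v ∉ Y := fun h => hS (hYS h)
      apply hR
      refine Finset.mem_filter.2 ⟨Finset.mem_sdiff.2 ⟨hvA, hvY⟩, fun f hf hfω => ?_⟩
      obtain ⟨y, hy, rfl⟩ := (hFmem v f).1 hf
      rw [Finset.mem_inter] at hy
      have := hST.mem_union y (hYS hy.2) v (mem_cubeNbrs_comm.1 hy.1) hv
        (by rw [Sym2.eq_swap]; exact hfω)
      rcases Finset.mem_union.1 this with h | h
      exacts [hS h, hT h]
    have h1 := Set.ncard_le_ncard hsub (Finset.finite_toSet _)
    rw [Set.ncard_coe_finset] at h1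
    have h2 : ω.1.ncard ≤ S.card + T.card + Aᶜ.card + (R ω).card := by
      refine h1.trans ((Finset.card_union_le _ _).trans ?_)
      gcongr
      refine (Finset.card_union_le _ _).trans ?_
      gcongr
      exact Finset.card_union_le _ _
    have h3 : n * ω.1.ncard ≤ n * (S.card + T.card + Aᶜ.card) + 2 ^ d := by
      have := Nat.mul_le_mul_left n h2
      rw [mul_add] at this
      omega
    exact_mod_cast h3

end RareEvents

/-! ### The union bound and the choice of parameters. -/

section Expansion

variable {d : ℕ}

lemma exists_sealed_of_not_highDegreeSetsExpand
    {ω : Set (Fin d → Bool) × Set (Sym2 (Fin d → Bool))} {δ c : ℝ}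
    (h : ¬ HighDegreeSetsExpand (retained (hypercube d) ω.1 ω.2) δ c) :
    ∃ S T : Finset (Fin d → Bool), IsSealed ω S T ∧ (S.card : ℝ) ≤ 3 * (ω.1.ncard : ℝ) / 4 ∧
      (∀ v ∈ S, δ ≤ (cubeNbrs v ∩ (S ∪ T)).card) ∧ (T.card : ℝ) < c * S.card := by
  classical
  unfold HighDegreeSetsExpand at h
  push Not at h
  obtain ⟨S, hS, hcard, hdeg, hext⟩ := h
  have hmem : ∀ a ∈ S, ∀ b, (retained (hypercube d) ω.1 ω.2).Adj a b →
      b ∈ S ∨ b ∈ extNbhd (retained (hypercube d) ω.1 ω.2) S := by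
    intro a ha b hab
    by_cases hb : b ∈ S
    · exact Or.inl hb
    · exact Or.inr ⟨Set.mem_iUnion₂.2 ⟨a, ha, hab⟩, hb⟩
  refine ⟨S.toFinset, (extNbhd (retained (hypercube d) ω.1 ω.2) S).toFinset, ⟨?_, ?_⟩, ?_, ?_, ?_⟩
  · intro a ha
    exact hS (Set.mem_toFinset.1 ha)
  · intro a ha b hab hb hs
    rw [Set.mem_toFinset] at ha
    rw [Finset.mem_union, Set.mem_toFinset, Set.mem_toFinset]
    exact hmem a ha b ⟨hypercube_adj_iff.2 hab, hS ha, hb, hs⟩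
  · rw [← Set.ncard_eq_toFinset_card']
    exact hcard
  · intro v hv
    rw [Set.mem_toFinset] at hv
    refine (hdeg v hv).trans ?_
    rw [← Set.ncard_coe_finset]
    refine Nat.cast_le.2 (Set.ncard_le_ncard (fun w hw => ?_) (Finset.finite_toSet _))
    rw [Finset.mem_coe, Finset.mem_inter, Finset.mem_union, Set.mem_toFinset, Set.mem_toFinset]
    exact ⟨hypercube_adj_iff.1 hw.1, hmem v hv w hw⟩
  · rw [← Set.ncard_eq_toFinset_card', ← Set.ncard_eq_toFinset_card']
    exact hext

/-- Here T contains the outer boundary of S, and S has density at most 3/4, so isoperimetry in the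
full cube suffices. This serves small dimensions. -/
lemma highDegreeSetsExpand_of_forall_mem (hd : 1 ≤ d)
    {ω : Set (Fin d → Bool) × Set (Sym2 (Fin d → Bool))}
    (h1 : ∀ v, v ∈ ω.1) (h2 : ∀ e ∈ (hypercube d).edgeSet, e ∈ ω.2) {γ : ℝ} (hγ : γ ≤ 1 / 4) (δ : ℝ) :
    HighDegreeSetsExpand (retained (hypercube d) ω.1 ω.2) δ (γ / √d) := by
  by_contra hcon
  obtain ⟨S, T, hST, hcard, -, hT⟩ := exists_sealed_of_not_highDegreeSetsExpand hcon
  have hs : (0 : ℝ) < √d := Real.sqrt_pos.2 (by exact_mod_cast hd)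
  have h3 : (ω.1.ncard : ℝ) ≤ 2 ^ d := by
    have := Set.ncard_le_card ω.1
    simp only [Nat.card_eq_fintype_card, Fintype.card_pi, Fintype.card_bool, Finset.prod_const,
      Finset.card_univ, Fintype.card_fin] at this
    exact_mod_cast this
  have h4 : density S ≤ 3 / 4 := by
    unfold density
    rw [div_le_iff₀ (by positivity)]
    linarith
  have h5 := card_mul_le_outerBoundary S
  have h6 : outerBoundary S ⊆ T := by
    intro x hx
    simp only [outerBoundary, Finset.mem_filter, Finset.mem_univ, true_and] at hx
    obtain ⟨hx, i, hi⟩ := hx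
    have h7 : x ∈ cubeNbrs (flip x i) := mem_cubeNbrs.2 ⟨i, flip_flip _ _⟩
    exact (Finset.mem_union.1 (hST.mem_union _ hi x h7 (h1 x) (h2 _ (mk_mem_edgeSet h7)))).resolve_left hx
  have h7 : ((outerBoundary S).card : ℝ) ≤ T.card := by exact_mod_cast Finset.card_le_card h6
  rw [div_mul_eq_mul_div, lt_div_iff₀ hs] at hT
  have h8 : (0 : ℝ) ≤ S.card := by positivity
  have h9 := mul_le_mul_of_nonneg_left h7 hs.le
  nlinarith [mul_le_mul_of_nonneg_right hγ h8, mul_le_mul_of_nonneg_left h4 h8]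

lemma exists_pos_le_measureReal_expand (hd : 1 ≤ d) {p q : unitInterval} (hp : 0 < p) (hq : 0 < q) :
    ∃ r : ℝ, 0 < r ∧ ∀ γ ≤ (1 / 4 : ℝ), ∀ δ : ℝ, r ≤ (mixedLaw (hypercube d) p q).real
      {ω | HighDegreeSetsExpand (retained (hypercube d) ω.1 ω.2) δ (γ / √d)} := by
  classical
  have h := mixedLaw_real_superset (hypercube d) p q Finset.univ
    ((hypercube d).edgeSet.toFinset) (by simp)
  refine ⟨_, ?_, fun γ hγ δ => h.symm.le.trans (measureReal_mono (fun ω hω => ?_))⟩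
  · have hp' : (0 : ℝ) < p := hp
    have hq' : (0 : ℝ) < q := hq
    positivity
  · refine highDegreeSetsExpand_of_forall_mem hd (fun v => hω.1 (by simp)) (fun e he => hω.2 ?_) hγ δ
    simpa using he

/-- Outside of an event of small probability, `Y` is not a fingerprint of a poorly expanding set
of size `s`. -/
lemma exists_rare_event (hd : 1 ≤ d) {p q : unitInterval} (hp : 0 < p) (hq : 0 < q) {n L : ℕ}
    (hn : 64 / (p : ℝ) ≤ n) (hL : (1 - q : ℝ) ^ L ≤ 1 / 8) (hL1 : 1 ≤ L) {α : ℝ} (hα : 0 < α)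
    (hα1 : α ≤ 1) {β γ : ℝ} (hβ : β = (p : ℝ) ^ 3 * (q : ℝ) ^ 2 / 2048) (hγ : γ = α ^ 2 * β / 13)
    (Y : Finset (Fin d → Bool)) {s : ℕ} (hs : s ≤ 2 ^ d) :
    ∃ B : Set (Set (Fin d → Bool) × Set (Sym2 (Fin d → Bool))),
      (mixedLaw (hypercube d) p q).real B ≤ Real.exp (-(β * (s / √d))) ∧
      ∀ ω ∉ B, ∀ S T, IsSealed ω S T → Y ⊆ S → S.card = s → (S.card : ℝ) ≤ 3 * (ω.1.ncard : ℝ) / 4 →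
        p * 2 ^ d / 4 < (ω.1.ncard : ℝ) → (T.card : ℝ) ≤ γ * (s / √d) →
        ((S \ robustNbhd (n * L) Y).card : ℝ) ≤ 11 / α ^ 2 * γ * (s / √d) → False := by
  have hp' : (0 : ℝ) < p := hp
  have hq' : (0 : ℝ) < q := hq
  have hp1 : (p : ℝ) ≤ 1 := p.2.2
  have hq1 : (q : ℝ) ≤ 1 := q.2.2
  have hd1 : (1 : ℝ) ≤ √d := by rw [Real.one_le_sqrt]; exact_mod_cast hd
  have hd0 : (0 : ℝ) < √d := by linarith
  have hβ0 : 0 < β := by rw [hβ]; positivity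
  have hβp : β ≤ p / 2048 := by
    rw [hβ]
    gcongr
    calc (p : ℝ) ^ 3 * (q : ℝ) ^ 2 ≤ (p : ℝ) ^ 1 * 1 :=
          mul_le_mul (pow_le_pow_of_le_one hp'.le hp1 (by norm_num)) (pow_le_one₀ hq'.le hq1)
            (by positivity) (by positivity)
      _ = (p : ℝ) := by ring
  have hγα : 13 / α ^ 2 * γ = β := by rw [hγ]; field_simp
  have hγ0 : 0 < γ := by rw [hγ]; positivity
  have hγβ : γ ≤ β := by
    rw [hγ]
    have : α ^ 2 ≤ 1 := pow_le_one₀ hα.le hα1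
    nlinarith
  have hσ0 : (0 : ℝ) ≤ s / √d := by positivity
  have hσs : s / √d ≤ (s : ℝ) := div_le_self (by positivity) hd1
  have hsN : (s : ℝ) ≤ 2 ^ d := by exact_mod_cast hs
  have hn0 : (0 : ℝ) < n := lt_of_lt_of_le (by positivity) hn
  have hn1 : 1 ≤ n := by exact_mod_cast hn0
  set A := robustNbhd (n * L) Y with hA
  have hSA : ∀ S : Finset (Fin d → Bool), S.card = s →
      ((S \ A).card : ℝ) ≤ 11 / α ^ 2 * γ * (s / √d) → (s : ℝ) ≤ 2 * A.card := by
    intro S hS h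
    have h1 : S.card ≤ (S \ A).card + A.card := Finset.card_le_card_sdiff_add_card
    have h2 : (s : ℝ) ≤ (S \ A).card + A.card := by rw [← hS]; exact_mod_cast h1
    have h3 : 11 / α ^ 2 * γ ≤ 1 / 2 := by
      have : 11 / α ^ 2 * γ = 11 / 13 * β := by rw [← hγα]; ring
      rw [this]; linarith
    have h4 := mul_le_mul h3 hσs hσ0 (by norm_num)
    linarith
  -- With c = p/64 and |A| ≥ s/2, the matching bound p²q²c|A|/(16√d) is at least β s/√d. In γ =
  -- α²β/13, the 13 is 2 for the term 2|T| plus 11 for S \ A.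
  by_cases hden : density A ≤ 1 - p / 64
  · by_cases hsA : (s : ℝ) ≤ 2 * A.card
    · obtain ⟨B, hB, hBω⟩ := exists_rare_event_of_density_le hd p q (L := n * L)
        (Nat.mul_pos hn1 hL1) Y (c := p / 64) (by positivity) hden
      have hle : β * (s / √d) ≤
          (p : ℝ) ^ 2 * (q : ℝ) ^ 2 * (p / 64) * (robustNbhd (n * L) Y).card / (16 * √d) := by
        rw [← hA]
        have : (p : ℝ) ^ 2 * (q : ℝ) ^ 2 * (p / 64) * A.card / (16 * √d) =
          β * ((2 * A.card) / √d) := by rw [hβ]; field_simp; ring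
        rw [this]
        gcongr
      refine ⟨B, hB.trans (Real.exp_le_exp.2 (neg_le_neg hle)), ?_⟩
      intro ω hω S T hST hYS hS _ _ hT hSA'
      have h1 := hBω ω hω S T hST hYS
      rw [← hA] at h1 hle
      have h2 : 2 * γ ≤ 2 / α ^ 2 * γ := by
        gcongr
        rw [le_div_iff₀ (by positivity)]
        nlinarith [pow_le_one₀ hα.le hα1 (n := 2)]
      have h3 : 2 * γ * (s / √d) ≤ 2 / α ^ 2 * γ * (s / √d) := by gcongr
      have h4 : 2 / α ^ 2 * γ * (s / √d) + 11 / α ^ 2 * γ * (s / √d) = β * (s / √d) := by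
        rw [← hγα]; ring
      linarith
    -- No event is needed: a small S \ A would force |A| ≥ s/2.
    · refine ⟨∅, by simp [Real.exp_nonneg], ?_⟩
      intro ω _ S T _ _ hS _ _ _ h
      exact hsA (hSA S hS h)
  · obtain ⟨B, hB, hBω⟩ := exists_rare_event_few_missed p q (n := n) hL Y
    refine ⟨B, hB.trans ?_, ?_⟩
    · have h1 : (1 / 4 : ℝ) ≤ Real.exp (-1) := by
        rw [Real.exp_neg, ← one_div]
        gcongr
        linarith [Real.exp_one_lt_d9]
      calc (1 / 4 : ℝ) ^ 2 ^ d ≤ Real.exp (-1) ^ 2 ^ d := by gcongr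
        _ = Real.exp (-(1 * 2 ^ d)) := by rw [← Real.exp_nat_mul]; congr 1; push_cast; ring
        _ ≤ _ := by
          apply Real.exp_le_exp.2 (neg_le_neg _)
          have hβ1 : β ≤ 1 := by linarith
          exact mul_le_mul hβ1 (hσs.trans hsN) hσ0 zero_le_one
    -- The vertices outside A, the exceptional ones and T together number less than p·2^d/16, which
    -- is less than a quarter of the retained vertices, so S would exceed three quarters.
    · intro ω hω S T hST hYS hS hS34 hV hT _
      have h1 := hBω ω hω S T hST hYS
      rw [← hA] at h1
      have h2 : (Aᶜ.card : ℝ) ≤ p / 64 * 2 ^ d := by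
        rw [Finset.card_compl, Nat.cast_sub (Finset.card_le_univ _)]
        simp only [Fintype.card_pi, Fintype.card_bool, Finset.prod_const, Finset.card_univ,
          Fintype.card_fin]
        unfold density at hden
        rw [not_le, lt_div_iff₀ (by positivity)] at hden
        push_cast
        linarith
      have h3 : (2 : ℝ) ^ d ≤ n * (p / 64 * 2 ^ d) := by
        have : 1 ≤ n * ((p : ℝ) / 64) := by
          rw [div_le_iff₀ hp'] at hn
          linarith
        nlinarith [show (0 : ℝ) < 2 ^ d by positivity]
      have h4 : (T.card : ℝ) ≤ p / 2048 * 2 ^ d := by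
        refine hT.trans ?_
        gcongr
        · exact hγβ.trans hβp
        · exact hσs.trans hsN
      have h5 : (ω.1.ncard : ℝ) ≤ S.card + T.card + Aᶜ.card + p / 64 * 2 ^ d := by
        refine le_of_mul_le_mul_left ?_ hn0
        rw [mul_add]
        linarith
      have h6 : (0 : ℝ) < p * 2 ^ d := by positivity
      linarith

/-- The union bound over all fingerprints. -/
lemma measureReal_not_expand_le (hd : 1 ≤ d) {p q : unitInterval} (hp : 0 < p) (hq : 0 < q)
    {n L : ℕ} (hn : 64 / (p : ℝ) ≤ n) (hL : (1 - q : ℝ) ^ L ≤ 1 / 8) (hL1 : 1 ≤ L) {α : ℝ}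
    (hα : 0 < α) (hα1 : α ≤ 1) {β γ κ a : ℝ} (hβ : β = (p : ℝ) ^ 3 * (q : ℝ) ^ 2 / 2048)
    (hγ : γ = α ^ 2 * β / 13) (hκ : κ = β / 8) (ha : a = α ^ 2 / (64 * (n * L : ℕ)))
    (hd1 : 8 * (n * L : ℕ) ≤ α * d) (hd2 : 1 ≤ κ * a * √d)
    (hd3 : (n * L : ℕ) * Real.exp (-(κ * a * √d)) ≤ γ / √d)
    (hd4 : d + 2 ≤ β * a / 4 * (d * √d)) (hd5 : β * a / 4 * (d * √d) + 1 ≤ p * 2 ^ d / 4) :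
    (mixedLaw (hypercube d) p q).real
      {ω | ¬ HighDegreeSetsExpand (retained (hypercube d) ω.1 ω.2) (α * d) (γ / √d)} ≤
      Real.exp (-(β * a / 4 * (d * √d))) := by
  classical
  have hp' : (0 : ℝ) < p := hp
  have hq' : (0 : ℝ) < q := hq
  have hβ0 : 0 < β := by rw [hβ]; positivity
  have hγ0 : 0 < γ := by rw [hγ]; positivity
  have hκ0 : 0 < κ := by rw [hκ]; positivity
  have hn0 : (0 : ℝ) < n := lt_of_lt_of_le (by positivity) hn
  have hn1 : 1 ≤ n := by exact_mod_cast hn0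
  have hnL : 1 ≤ n * L := Nat.mul_pos hn1 hL1
  have hnL0 : (0 : ℝ) < (n * L : ℕ) := by exact_mod_cast hnL
  have ha0 : 0 < a := by rw [ha]; positivity
  have hdr : (0 : ℝ) < d := by exact_mod_cast hd
  have hs1 : (1 : ℝ) ≤ √d := by rw [Real.one_le_sqrt]; exact_mod_cast hd
  have hs0 : (0 : ℝ) < √d := by linarith
  have hsq : √(d : ℝ) * √d = d := Real.mul_self_sqrt hdr.le
  have hβ1 : β ≤ 1 / 2048 := by
    rw [hβ]
    gcongr
    exact mul_le_one₀ (pow_le_one₀ hp'.le p.2.2) (by positivity) (pow_le_one₀ hq'.le q.2.2)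
  have hγ' : 10 / α ^ 2 * γ < 1 := by
    have : 10 / α ^ 2 * γ = 10 / 13 * β := by rw [hγ]; field_simp
    linarith
  choose! B hB hBω using fun (Y : Finset (Fin d → Bool)) (s : ℕ) (hs : s ≤ 2 ^ d) =>
    exists_rare_event hd hp hq hn hL hL1 hα hα1 hβ hγ Y hs
  -- Since `hd2` makes the ceiling at most double, κ = β/8 gives 2dk ≤ (β/2)s/√d: the fingerprints
  -- cost half of the exponent.
  let k : ℕ → ℕ := fun s => ⌈κ * s / (d * √d)⌉₊
  let sizes : Finset ℕ := (Finset.range (2 ^ d + 1)).filter fun s => a * d ^ 2 ≤ s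
  let few : Set (Set (Fin d → Bool) × Set (Sym2 (Fin d → Bool))) :=
    {ω | (ω.1.ncard : ℝ) ≤ p * 2 ^ d / 4}
  have hsub : {ω | ¬ HighDegreeSetsExpand (retained (hypercube d) ω.1 ω.2) (α * d) (γ / √d)} ⊆
      few ∪ ⋃ s ∈ sizes, ⋃ Y ∈ fingerprints d (k s), B Y s := by
    intro ω hω
    obtain ⟨S, T, hST, hcard, hdeg, hT⟩ := exists_sealed_of_not_highDegreeSetsExpand hω
    by_contra hcon
    simp only [Set.mem_union, not_or, Set.mem_iUnion, not_exists] at hcon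
    obtain ⟨hfew, hcon⟩ := hcon
    have hV : p * 2 ^ d / 4 < (ω.1.ncard : ℝ) := not_le.1 hfew
    have hT' : (T.card : ℝ) ≤ γ * (S.card / √d) := by
      refine hT.le.trans (le_of_eq ?_); ring
    have hSpos : (0 : ℝ) < S.card := by
      by_contra h
      have h1 : (S.card : ℝ) = 0 := le_antisymm (not_lt.1 h) (by positivity)
      rw [h1, mul_zero] at hT
      exact absurd hT (not_lt.2 (by positivity))
    have hσ : (S.card : ℝ) / √d ≤ S.card := div_le_self hSpos.le hs1
    have hTS : 10 / α ^ 2 * T.card < S.card := by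
      calc 10 / α ^ 2 * T.card ≤ 10 / α ^ 2 * (γ * S.card) := by
            gcongr
            exact hT'.trans (by gcongr)
        _ = 10 / α ^ 2 * γ * S.card := by ring
        _ < 1 * S.card := by gcongr
        _ = S.card := one_mul _
    obtain ⟨hD, hfp⟩ := exists_fingerprint hd hα hα1 hnL hd1 hdeg hTS
    rw [← ha] at hD
    obtain ⟨Y, hYf, hYS, hYc⟩ := hfp (k S.card)
    rw [← ha] at hYc
    have hSN : S.card ≤ 2 ^ d := (Finset.card_le_univ _).trans (by simp)
    have hmiss : (1 - a * d ^ 2 / S.card) ^ k S.card ≤ Real.exp (-(κ * a * √d)) := by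
      have h0 : 0 ≤ 1 - a * d ^ 2 / S.card := sub_nonneg.2 ((div_le_one hSpos).2 hD)
      calc (1 - a * d ^ 2 / S.card) ^ k S.card ≤ Real.exp (-(a * d ^ 2 / S.card)) ^ k S.card := by
            gcongr
            exact Real.one_sub_le_exp_neg _
        _ = Real.exp (-(k S.card * (a * d ^ 2 / S.card))) := by
            rw [← Real.exp_nat_mul]; congr 1; ring
        _ ≤ _ := by
            apply Real.exp_le_exp.2 (neg_le_neg _)
            calc κ * a * √d = κ * S.card / (d * √d) * (a * d ^ 2 / S.card) := by
                  field_simp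
                  rw [sq, hsq]
              _ ≤ _ := by
                  gcongr
                  exact Nat.le_ceil _
    refine hBω Y S.card hSN ω ?_ S T hST hYS rfl hcard hV hT' ?_
    · refine hcon S.card ?_ Y hYf
      exact Finset.mem_filter.2 ⟨Finset.mem_range.2 (by omega), hD⟩
    · refine hYc.trans ?_
      have h1 : ((n * L : ℕ) : ℝ) * S.card * (1 - a * d ^ 2 / S.card) ^ k S.card ≤
          γ * (S.card / √d) := by
        calc _ ≤ ((n * L : ℕ) : ℝ) * S.card * Real.exp (-(κ * a * √d)) := by gcongr
          _ = S.card * ((n * L : ℕ) * Real.exp (-(κ * a * √d))) := by ring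
          _ ≤ S.card * (γ / √d) := by gcongr
          _ = _ := by ring
      have h2 : 10 / α ^ 2 * T.card ≤ 10 / α ^ 2 * (γ * (S.card / √d)) := by gcongr
      have h3 : γ * (S.card / √d) ≤ 1 / α ^ 2 * (γ * (S.card / √d)) := by
        refine le_mul_of_one_le_left (by positivity) ?_
        rw [one_le_div (by positivity)]
        exact pow_le_one₀ hα.le hα1
      have h4 : 11 / α ^ 2 * γ * (S.card / √d) =
        10 / α ^ 2 * (γ * (S.card / √d)) + 1 / α ^ 2 * (γ * (S.card / √d)) := by ring
      linarith
  have hfewp : (mixedLaw (hypercube d) p q).real few ≤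
      Real.exp (-(β * a / 4 * (d * √d))) / 2 := by
    refine (measureReal_few_vertices_le p q).trans ?_
    calc Real.exp (-(p * 2 ^ d / 4)) ≤ Real.exp (-(β * a / 4 * (d * √d)) + -1) :=
          Real.exp_le_exp.2 (by linarith)
      _ = Real.exp (-(β * a / 4 * (d * √d))) * Real.exp (-1) := Real.exp_add _ _
      _ ≤ Real.exp (-(β * a / 4 * (d * √d))) * (1 / 2) := by
          gcongr
          rw [Real.exp_neg, ← one_div]
          gcongr
          linarith [Real.add_one_le_exp 1]
      _ = _ := by ring
  have hsize : ∀ s ∈ sizes, (mixedLaw (hypercube d) p q).real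
      (⋃ Y ∈ fingerprints d (k s), B Y s) ≤ Real.exp (-(β * a / 2 * (d * √d))) := by
    intro s hs
    obtain ⟨hsN, hsa⟩ := Finset.mem_filter.1 hs
    rw [Finset.mem_range] at hsN
    have hexp : a * (d * √d) ≤ s / √d := by
      rw [le_div_iff₀ hs0]
      refine le_trans (le_of_eq ?_) hsa
      rw [mul_assoc, mul_assoc, hsq, sq]
    have hk : 2 * d * (k s : ℝ) ≤ β / 2 * (s / √d) := by
      have h1 : (k s : ℝ) < κ * s / (d * √d) + 1 := Nat.ceil_lt_add_one (by positivity)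
      have h2 : 1 ≤ κ * s / (d * √d) := by
        refine hd2.trans ?_
        rw [le_div_iff₀ (by positivity)]
        calc κ * a * √d * (d * √d) = κ * (a * (d * (√d * √d))) := by ring
          _ = κ * (a * d ^ 2) := by rw [hsq, sq]
          _ ≤ _ := by gcongr
      calc 2 * d * (k s : ℝ) ≤ 2 * d * (2 * (κ * s / (d * √d))) := by gcongr; linarith
        _ = _ := by rw [hκ]; field_simp; norm_num
    refine (measureReal_biUnion_finset_le _ _).trans ?_
    refine (Finset.sum_le_card_nsmul _ _ _ fun Y _ => hB Y s (by omega)).trans ?_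
    rw [nsmul_eq_mul]
    have h1 : ((fingerprints d (k s)).card : ℝ) ≤ Real.exp (2 * d * (k s : ℝ)) := by
      calc ((fingerprints d (k s)).card : ℝ) ≤ (2 : ℝ) ^ (2 * d * k s) := by
            exact_mod_cast card_fingerprints_le d (k s)
        _ ≤ Real.exp 1 ^ (2 * d * k s) := by
            gcongr
            linarith [Real.add_one_le_exp 1]
        _ = _ := by rw [← Real.exp_nat_mul]; congr 1; push_cast; ring
    calc _ ≤ Real.exp (2 * d * (k s : ℝ)) * Real.exp (-(β * (s / √d))) := by gcongr
      _ = Real.exp (2 * d * (k s : ℝ) + -(β * (s / √d))) := (Real.exp_add _ _).symm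
      _ ≤ _ := by
          apply Real.exp_le_exp.2
          have := mul_le_mul_of_nonneg_left hexp (show 0 ≤ β / 2 by positivity)
          linarith
  refine (measureReal_mono hsub).trans ((measureReal_union_le _ _).trans ?_)
  have hsum : (mixedLaw (hypercube d) p q).real (⋃ s ∈ sizes, ⋃ Y ∈ fingerprints d (k s), B Y s) ≤
      Real.exp (-(β * a / 4 * (d * √d))) / 2 := by
    refine (measureReal_biUnion_finset_le _ _).trans ((Finset.sum_le_card_nsmul _ _ _ hsize).trans ?_)
    rw [nsmul_eq_mul]
    have h1 : sizes.card ≤ 2 ^ (d + 1) := by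
      refine (Finset.card_filter_le _ _).trans ?_
      rw [Finset.card_range, pow_succ]
      have := Nat.one_le_two_pow (n := d)
      omega
    have h2 : (2 : ℝ) * sizes.card ≤ Real.exp (d + 2) := by
      calc (2 : ℝ) * sizes.card ≤ 2 * 2 ^ (d + 1) := by gcongr; exact_mod_cast h1
        _ = 2 ^ (d + 2) := by ring
        _ ≤ Real.exp 1 ^ (d + 2) := by
            gcongr
            linarith [Real.add_one_le_exp 1]
        _ = _ := by rw [← Real.exp_nat_mul]; congr 1; push_cast; ring
    rw [le_div_iff₀ (by norm_num)]
    calc _ = 2 * sizes.card * Real.exp (-(β * a / 2 * (d * √d))) := by ring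
      _ ≤ Real.exp (d + 2) * Real.exp (-(β * a / 2 * (d * √d))) := by gcongr
      _ = Real.exp (d + 2 + -(β * a / 2 * (d * √d))) := (Real.exp_add _ _).symm
      _ ≤ _ := Real.exp_le_exp.2 (by linarith)
  linarith

open Filter in
/-- In high dimension, poorly expanding sets are unlikely. -/
lemma exists_forall_measureReal_not_expand_le {p q : unitInterval} (hp : 0 < p) (hq : 0 < q) {α : ℝ}
    (hα : 0 < α) (hα1 : α ≤ 1) :
    ∃ γ : ℝ, 0 < γ ∧ ∃ c : ℝ, 0 < c ∧ ∀ᶠ d : ℕ in atTop,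
      (mixedLaw (hypercube d) p q).real
        {ω | ¬ HighDegreeSetsExpand (retained (hypercube d) ω.1 ω.2) (α * d) (γ / √d)} ≤
        Real.exp (-(c * (d * √d))) := by
  have hp' : (0 : ℝ) < p := hp
  have hq' : (0 : ℝ) < q := hq
  obtain ⟨n, hn⟩ := exists_nat_ge (64 / (p : ℝ))
  obtain ⟨L, hL⟩ := exists_pow_lt_of_lt_one (show (0 : ℝ) < 1 / 8 by norm_num)
    (show (1 - q : ℝ) < 1 by linarith)
  have hL1 : 1 ≤ L := by
    rcases Nat.eq_zero_or_pos L with rfl | h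
    · norm_num at hL
    · exact h
  have hn0 : (0 : ℝ) < n := lt_of_lt_of_le (by positivity) hn
  have hL0 : (0 : ℝ) < L := by exact_mod_cast hL1
  set β : ℝ := (p : ℝ) ^ 3 * (q : ℝ) ^ 2 / 2048 with hβ
  set γ : ℝ := α ^ 2 * β / 13 with hγ
  set κ : ℝ := β / 8 with hκ
  set a : ℝ := α ^ 2 / (64 * (n * L : ℕ)) with ha
  have hβ0 : 0 < β := by positivity
  have hγ0 : 0 < γ := by positivity
  have hκ0 : 0 < κ := by positivity
  have hnL0 : (0 : ℝ) < (n * L : ℕ) := by push_cast; positivity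
  have ha0 : 0 < a := by positivity
  refine ⟨γ, hγ0, β * a / 4, by positivity, ?_⟩
  have hsqrt : Tendsto (fun d : ℕ => √(d : ℝ)) atTop atTop :=
    Real.tendsto_sqrt_atTop.comp tendsto_natCast_atTop_atTop
  have hpow : Tendsto (fun d : ℕ => (d : ℝ) ^ 2 / 2 ^ d) atTop (nhds 0) :=
    tendsto_pow_const_div_const_pow_of_one_lt 2 (by norm_num)
  filter_upwards [eventually_ge_atTop 1, tendsto_natCast_atTop_atTop.eventually_ge_atTop (8 * (n * L : ℕ) / α),
    hsqrt.eventually_ge_atTop (1 / (κ * a)),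
    hsqrt.eventually_ge_atTop (2 * (n * L : ℕ) / ((κ * a) ^ 2 * γ)),
    hsqrt.eventually_ge_atTop (3 / (β * a / 4)),
    hpow.eventually_le_const (show (0 : ℝ) < p / 4 / (β * a / 4 + 1) by positivity)]
    with d hd h1 h2 h3 h4 h5
  have hdr : (1 : ℝ) ≤ d := by exact_mod_cast hd
  have hs1 : (1 : ℝ) ≤ √d := by rwa [Real.one_le_sqrt]
  have hs0 : (0 : ℝ) < √d := by linarith
  have hsq : √(d : ℝ) * √d = d := Real.mul_self_sqrt (by linarith)
  refine measureReal_not_expand_le hd hp hq hn hL.le hL1 hα hα1 hβ hγ hκ ha ?_ ?_ ?_ ?_ ?_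
  · rw [div_le_iff₀ hα] at h1
    linarith
  · rw [div_le_iff₀ (by positivity)] at h2
    linarith
  -- The bound exp x ≥ x²/2 at x = κa√d gives decay of order 1/d, more than the required 1/√d.
  · have h6 := Real.quadratic_le_exp_of_nonneg (show 0 ≤ κ * a * √d by positivity)
    have h7 : (κ * a) ^ 2 * d / 2 ≤ Real.exp (κ * a * √d) := by
      have : (κ * a * √d) ^ 2 = (κ * a) ^ 2 * d := by rw [mul_pow, Real.sq_sqrt (by linarith)]
      rw [this] at h6
      have : 0 ≤ κ * a * √d := by positivity
      linarith
    rw [div_le_iff₀ (by positivity)] at h3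
    rw [Real.exp_neg, ← div_eq_mul_inv, div_le_div_iff₀ (Real.exp_pos _) hs0]
    calc ((n * L : ℕ) : ℝ) * √d ≤ √d * ((κ * a) ^ 2 * γ) / 2 * √d := by gcongr; linarith
      _ = γ * ((κ * a) ^ 2 * (√d * √d) / 2) := by ring
      _ = γ * ((κ * a) ^ 2 * d / 2) := by rw [hsq]
      _ ≤ _ := by gcongr
  · rw [div_le_iff₀ (by positivity)] at h4
    nlinarith
  · rw [div_le_div_iff₀ (by positivity) (by positivity)] at h5
    have h6 : (d : ℝ) * √d ≤ d ^ 2 := by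
      rw [sq]
      gcongr
      rw [Real.sqrt_le_left (by linarith)]
      nlinarith
    have h7 : β * a / 4 * (d * √d) ≤ β * a / 4 * d ^ 2 := by gcongr
    have h8 : (1 : ℝ) ≤ d ^ 2 := one_le_pow₀ hdr
    linarith

lemma HighDegreeSetsExpand.mono {V : Type*} {G : SimpleGraph V} {H : G.Subgraph} {δ c c' : ℝ}
    (h : HighDegreeSetsExpand H δ c) (hc : c' ≤ c) : HighDegreeSetsExpand H δ c' :=
  fun S hS h1 h2 => (mul_le_mul_of_nonneg_right hc (by positivity)).trans (h S hS h1 h2)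

end Expansion

end MixedPercolation

open MixedPercolation in
theorem proposition5p1 :
    ∃ g : ℝ → ℝ, (∀ η : ℝ, 0 < η → 0 < g η) ∧
      ∀ p q : unitInterval, 0 < p → 0 < q → ∀ α : ℝ, 0 < α → α ≤ 1 →
        ∃ η₀ : ℝ, 0 < η₀ ∧
          ∀ η : ℝ, 0 < η → η ≤ η₀ → ∀ γ : ℝ, 0 < γ → γ ≤ g η →
            ∀ d : ℕ, 1 ≤ d →
              1 - (2 : ℝ) ^ (-(η * (d : ℝ) ^ (3 / 2 : ℝ))) ≤
                (MixedPercolation.mixedLaw (MixedPercolation.hypercube d) p q).real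
                  {ω | MixedPercolation.HighDegreeSetsExpand
                    (MixedPercolation.retained (MixedPercolation.hypercube d) ω.1 ω.2)
                    (α * d) (γ / √(d : ℝ))} := by
  -- The identity serves as g: γ ≤ η ≤ η₀, and η₀ is chosen below every bound that γ must satisfy.
  refine ⟨id, fun η hη => hη, fun p q hp hq α hα hα1 => ?_⟩
  obtain ⟨γ₁, hγ₁, c, hc, hev⟩ := exists_forall_measureReal_not_expand_le hp hq hα hα1
  obtain ⟨d₀, hd₀⟩ := Filter.eventually_atTop.1 hev
  choose! r hr hrle using fun (d : ℕ) (hd : 1 ≤ d) => exists_pos_le_measureReal_expand hd hp hq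
  obtain ⟨ρ, hρ, hρle⟩ : ∃ ρ : ℝ, 0 < ρ ∧ ∀ d, 1 ≤ d → d < d₀ → ρ ≤ r d := by
    rcases (Finset.Ico 1 d₀).eq_empty_or_nonempty with h | h
    · refine ⟨1, one_pos, fun d h1 h2 => ?_⟩
      have : d ∈ Finset.Ico 1 d₀ := Finset.mem_Ico.2 ⟨h1, h2⟩
      simp [h] at this
    · obtain ⟨m, hm, hmin⟩ := Finset.exists_min_image _ r h
      exact ⟨r m, hr m (Finset.mem_Ico.1 hm).1, fun d h1 h2 => hmin d (Finset.mem_Ico.2 ⟨h1, h2⟩)⟩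
  have hlog : 0 < Real.log 2 := Real.log_pos (by norm_num)
  have hlog1 : Real.log 2 ≤ 1 := by linarith [Real.log_two_lt_d9]
  have hpow : ∀ d : ℕ, 1 ≤ d → (d : ℝ) ^ (3 / 2 : ℝ) = d * √d := by
    intro d hd
    have : (0 : ℝ) < d := by exact_mod_cast hd
    rw [show (3 / 2 : ℝ) = 1 + 1 / 2 by norm_num, Real.rpow_add this, Real.rpow_one,
      Real.sqrt_eq_rpow]
  have hexp : ∀ η : ℝ, ∀ d : ℕ, 1 ≤ d → (2 : ℝ) ^ (-(η * (d : ℝ) ^ (3 / 2 : ℝ))) =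
      Real.exp (-(Real.log 2 * η * (d * √d))) := by
    intro η d hd
    rw [hpow d hd, Real.rpow_def_of_pos (by norm_num)]
    congr 1
    ring
  refine ⟨min (min (1 / 4) γ₁) (min c (ρ / (d₀ * √d₀ + 1))), by positivity, ?_⟩
  intro η hη hη₀ γ hγ hγη d hd
  have hη1 : η ≤ 1 / 4 := hη₀.trans ((min_le_left _ _).trans (min_le_left _ _))
  have hη2 : η ≤ γ₁ := hη₀.trans ((min_le_left _ _).trans (min_le_right _ _))
  have hη3 : η ≤ c := hη₀.trans ((min_le_right _ _).trans (min_le_left _ _))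
  have hη4 : η ≤ ρ / (d₀ * √d₀ + 1) := hη₀.trans ((min_le_right _ _).trans (min_le_right _ _))
  have hγ' : γ ≤ η := hγη
  rw [hexp η d hd]
  rcases lt_or_ge d d₀ with hlt | hge
  -- For small d, 1 - exp(-x) ≤ x with x = η·log 2·d^{3/2}, and the choice of η₀ makes x at most ρ.
  · refine le_trans ?_ ((hρle d hd hlt).trans (hrle d hd γ (hγ'.trans hη1) (α * d)))
    have h1 := Real.add_one_le_exp (-(Real.log 2 * η * (d * √d)))
    have h2 : (d : ℝ) * √d ≤ d₀ * √d₀ + 1 := by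
      have : (d : ℝ) ≤ d₀ := by exact_mod_cast hlt.le
      have : (d : ℝ) * √d ≤ d₀ * √d₀ := by gcongr
      linarith
    have h3 : Real.log 2 * η * (d * √d) ≤ 1 * (ρ / (d₀ * √d₀ + 1)) * (d₀ * √d₀ + 1) := by gcongr
    rw [one_mul, div_mul_cancel₀ _ (by positivity)] at h3
    linarith
  · set good := {ω : Set (Fin d → Bool) × Set (Sym2 (Fin d → Bool)) | HighDegreeSetsExpand
      (retained (hypercube d) ω.1 ω.2) (α * d) (γ / √(d : ℝ))} with hgood
    have h1 : (mixedLaw (hypercube d) p q).real goodᶜ ≤ Real.exp (-(c * (d * √d))) := by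
      refine (measureReal_mono fun ω hω => ?_).trans (hd₀ d hge)
      intro hcon
      exact hω (hcon.mono (by gcongr; exact hγ'.trans hη2))
    -- Subadditivity suffices here, so the measurability of `good` is not needed.
    have h2 : (1 : ℝ) ≤ (mixedLaw (hypercube d) p q).real good +
        (mixedLaw (hypercube d) p q).real goodᶜ := by
      have := measureReal_union_le (μ := mixedLaw (hypercube d) p q) good goodᶜ
      rwa [Set.union_compl_self, probReal_univ] at this
    have h3 : Real.exp (-(c * (d * √d))) ≤ Real.exp (-(Real.log 2 * η * (d * √d))) := by
      apply Real.exp_le_exp.2 (neg_le_neg _)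
      have : Real.log 2 * η ≤ c := by nlinarith
      gcongr
    linarith
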